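/- Let $\mathbb{R}^{1,2}$ be $\mathbb{R}^3$ with the form $\langle x,y\rangle=-x_0y_0+x_1y_1+x_2y_2$, let $\boxtimes$ be its cross product, $\langle x\boxtimes y,v\rangle=\det(x,y,v)$, and let $\mathbb{H}^2=\{\langle x,x\rangle=-1,\ x_0>0\}$, with hyperbolic metric and complex structure $\mathrm{J}_p(v)=p\boxtimes v$. Let $\mathbb{D}^2$ and $\mathbb{B}^2$ both denote the open unit disk of $\mathbb{C}$ (Klein and Poincaré model, respectively). Let $\Gamma(\mathbb{S}^1)$ and $\Gamma(\mathbb{H}^2)$ be the real vector spaces of continuous tangent vector fields on the unit circle and on $\mathbb{H}^2$, with the compact-open topology. For $X\in\Gamma(\mathbb{S}^1)$ let $\phi_X:\mathbb{S}^1\to\mathbb{R}$ be its support function, $X(z)=iz\,\phi_X(z)$. For $u:\mathbb{H}^2\to\mathbb{R}$ define $\overline{u}:\mathbb{D}^2\to\mathbb{R}$ by $$\overline{u}(\eta)=\sqrt{1-|\eta|^2}\;u\!\left(\tfrac{(1,\eta)}{\sqrt{1-|\eta|^2}}\right),$$ and write $\overline{u}|_{\mathbb{S}^1}=\phi$ if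 $\overline{u}$ extends continuously by $\phi$ to the unit circle. Half-pipe space $\mathbb{HP}^3$ is identified with $\mathbb{H}^2\times\mathbb{R}=\{(p,t)\in\mathbb{R}^3\times\mathbb{R}: p\in\mathbb{H}^2\}\subset\mathbb{R}^4$. It carries the connection $\nabla_VW=D_VW-\langle V,W\rangle N$, where $D$ is the flat connection of $\mathbb{R}^4$, $N_x=x$ is the position vector, and $\langle V,W\rangle$ is the form of $\mathbb{R}^{1,2}$ applied to the first three coordinates. The graph $S=\mathrm{gr}(u)$ of a smooth function $u:\mathbb{H}^2\to\mathbb{R}$ has the hyperbolic metric as first fundamental form; its shape operator $\mathrm{B}$ is defined by $\nabla_VW=\nabla^{\mathbb{H}^2}_VW+\langle \mathrm{B}V,W\rangle\,(0,0,0,1)$ for tangent fields of $S$ (identified with fields on $\mathbb{H}^2$), and $S$ is called mean if $\mathrm{tr}\,\mathrm{B}=0$. The vector field $V_S$ on $\mathbb{H}^2$ associated with $S$ is $V_S(p)=p\boxtimes\sigma$, where $\sigma\in\mathbb{R}^{1,2}$ is the vector such that $\eta\mapsto\langle(1,\eta),\sigma\rangle$ is the affine function tangent to $\overline{u}$ at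 $\eta_0=(p_1/p_0,\,p_2/p_0)$. Let $G:\mathbb{H}^2\to\mathbb{B}^2$, $G(x_0,x_1,x_2)=\left(\frac{x_1}{1+x_0},\frac{x_2}{1+x_0}\right)$, be the isometry onto the Poincaré disk, let $G_*$ be the push-forward of vector fields, and let $$L_0(X)(z)=\frac{(1-|z|^2)^3}{2\pi i}\int_{\mathbb{S}^1}\frac{X(x)}{(1-\overline{z}x)^3(x-z)}\,dx,\qquad z\in\mathbb{B}^2,$$ be the infinitesimal Douady–Earle extension. **Proposition.** For every $X\in\Gamma(\mathbb{S}^1)$ there is a unique smooth $u:\mathbb{H}^2\to\mathbb{R}$ whose graph is a mean surface and which satisfies $\overline{u}|_{\mathbb{S}^1}=\phi_X$; let $S_X$ be its graph. Also, there is a unique smooth solution $u_X:\mathbb{H}^2\to\mathbb{R}$ of $$\Delta^{\mathbb{H}^2}u_X-2u_X=0,\qquad \overline{u_X}|_{\mathbb{S}^1}=\phi_X .$$ There is a continuous linear operator $\mathrm{HL}:\Gamma(\mathbb{S}^1)\to\Gamma(\mathbb{H}^2)$ such that, for all $X$, $$\mathrm{HL}(X)=V_{S_X}=\mathrm{J}\,\mathrm{grad}^{\mathbb{H}^2}(u_X),$$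 and it satisfies $$G_*\mathrm{HL}=L_0 .$$ -/

import Mathlib

open scoped ContDiff

noncomputable section

namespace HalfPipe

/-! Minkowski space and the hyperboloid model. -/

/-- The vector space underlying Minkowski space, with coordinates `(x 0, x 1, x 2)`. -/
abbrev Mink := Fin 3 → ℝ

/-- The Lorentzian form of signature `(-,+,+)`. -/
def mink (x y : Mink) : ℝ := -(x 0 * y 0) + x 1 * y 1 + x 2 * y 2

/-- The Minkowski cross product, characterized by `mink_cross`. -/
def cross (x y : Mink) : Mink :=
  ![x 2 * y 1 - x 1 * y 2, x 2 * y 0 - x 0 * y 2, x 0 * y 1 - x 1 * y 0]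

theorem mink_cross (x y v : Mink) : mink (cross x y) v = (Matrix.of ![x, y, v]).det := by
  simp [mink, cross, Matrix.det_fin_three]
  ring

/-- The open future cone. -/
def futureCone : Set Mink := {x | mink x x < 0 ∧ 0 < x 0}

/-- The hyperbolic plane: the upper sheet of the hyperboloid. -/
def H2 : Set Mink := {x | mink x x = -1 ∧ 0 < x 0}

/-- The point of the hyperbolic plane on the ray spanned by a vector of the future cone. -/
def radial (x : Mink) (hx : x ∈ futureCone) : H2 :=
  ⟨fun i => x i / √(-mink x x), by
    obtain ⟨h1, h2⟩ := hx
    have hpos : 0 < √(-mink x x) := Real.sqrt_pos.2 (by linarith)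
    refine ⟨?_, div_pos h2 hpos⟩
    have hsq : √(-mink x x) * √(-mink x x) = -mink x x := Real.mul_self_sqrt (by linarith)
    have h3 : mink (fun i => x i / √(-mink x x)) (fun i => x i / √(-mink x x))
        = mink x x / (√(-mink x x) * √(-mink x x)) := by
      simp only [mink]
      field_simp
    rw [h3, hsq, div_neg, div_self h1.ne]⟩

theorem H2_subset_futureCone {p : Mink} (hp : p ∈ H2) : p ∈ futureCone :=
  ⟨by have := hp.1; linarith, hp.2⟩

theorem radial_of_mem_H2 (p : H2) : radial p (H2_subset_futureCone p.2) = p := by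
  apply Subtype.ext
  funext i
  simp [radial, p.2.1]

open Classical in
/-- The extension of a map on the hyperbolic plane to the future cone that is constant on rays
(and zero outside of the cone). -/
def radExt {E : Type*} [Zero E] (f : H2 → E) : Mink → E :=
  fun x => if hx : x ∈ futureCone then f (radial x hx) else 0

/-- Smoothness of a map on the hyperbolic plane: its extension that is constant on rays is smooth
on the (open) future cone. -/
def SmoothOnH2 {E : Type*} [NormedAddCommGroup E] [NormedSpace ℝ E] (f : H2 → E) : Prop :=
  ContDiffOn ℝ ∞ (radExt f) futureCone

/-- The differential at `p` of a map on the hyperbolic plane, for vectors tangent at `p`. -/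
def diffH2 {E : Type*} [NormedAddCommGroup E] [NormedSpace ℝ E] (f : H2 → E) (p : H2) :
    Mink →L[ℝ] E :=
  fderiv ℝ (radExt f) p

/-- The tangent plane of the hyperbolic plane at `p`. -/
def tangentH2 (p : Mink) : Submodule ℝ Mink where
  carrier := {v | mink p v = 0}
  add_mem' := by
    intro a b ha hb
    simp only [Set.mem_ofPred_eq, mink, Pi.add_apply] at *
    linarith
  zero_mem' := by simp [mink]
  smul_mem' := by
    intro c a ha
    simp only [Set.mem_ofPred_eq, mink, Pi.smul_apply, smul_eq_mul] at *
    linear_combination c * ha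

/-- The orthogonal projection onto the tangent plane at `p`. -/
def projTangent (p : H2) : Mink →ₗ[ℝ] tangentH2 p where
  toFun w := ⟨w + mink p w • (p : Mink), by
    have hp := p.2.1
    simp only [tangentH2, Submodule.mem_mk, AddSubmonoid.mem_mk, AddSubsemigroup.mem_mk,
      Set.mem_ofPred_eq, mink, Pi.add_apply, Pi.smul_apply, smul_eq_mul] at *
    linear_combination (-(p.1 0 * w 0) + p.1 1 * w 1 + p.1 2 * w 2) * hp⟩
  map_add' := by
    intro a b
    apply Subtype.ext
    funext i
    simp only [mink, Pi.add_apply, Submodule.coe_add, Pi.smul_apply, smul_eq_mul]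
    ring
  map_smul' := by
    intro c a
    apply Subtype.ext
    funext i
    simp only [mink, Pi.add_apply, Submodule.coe_smul, Pi.smul_apply, smul_eq_mul,
      RingHom.id_apply]
    ring

theorem projTangent_of_mem (p : H2) (v : tangentH2 p) : projTangent p v = v := by
  apply Subtype.ext
  have hv : mink p v = 0 := v.2
  simp [projTangent, hv]

/-- The hyperbolic gradient; see `mink_gradH2` and `gradH2_mem`. -/
def gradH2 (u : H2 → ℝ) (p : H2) : Mink :=
  ![-diffH2 u p (Pi.single 0 1), diffH2 u p (Pi.single 1 1), diffH2 u p (Pi.single 2 1)]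

theorem mink_gradH2 (u : H2 → ℝ) (p : H2) (v : Mink) : mink (gradH2 u p) v = diffH2 u p v := by
  have hv : v = v 0 • (Pi.single 0 1 : Mink) + v 1 • (Pi.single 1 1 : Mink)
      + v 2 • (Pi.single 2 1 : Mink) := by
    funext i
    fin_cases i <;> simp
  conv_rhs => rw [hv]
  simp only [map_add, map_smul, smul_eq_mul, mink, gradH2]
  simp
  ring

/-- The extension that is constant on rays has zero derivative in the radial direction. -/
theorem diffH2_self {E : Type*} [NormedAddCommGroup E] [NormedSpace ℝ E] (f : H2 → E) (p : H2) :
    diffH2 f p p = 0 := by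
  by_cases hd : DifferentiableAt ℝ (radExt f) (p : Mink)
  · have h1 : HasDerivAt (fun t : ℝ => t • (p : Mink)) (p : Mink) 1 := by
      simpa using (hasDerivAt_id (1 : ℝ)).smul_const (p : Mink)
    have h2 : HasFDerivAt (radExt f) (fderiv ℝ (radExt f) p) ((1 : ℝ) • (p : Mink)) := by
      simpa using hd.hasFDerivAt
    have h3 := h2.comp_hasDerivAt (1 : ℝ) h1
    have h4 : (radExt f ∘ fun t : ℝ => t • (p : Mink)) =ᶠ[nhds 1] fun _ => f p := by
      filter_upwards [lt_mem_nhds (zero_lt_one : (0 : ℝ) < 1)] with t ht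
      have hm : mink (t • (p : Mink)) (t • (p : Mink)) = -t ^ 2 := by
        have hp := p.2.1
        simp only [mink, Pi.smul_apply, smul_eq_mul] at *
        linear_combination t ^ 2 * hp
      have hc : t • (p : Mink) ∈ futureCone := by
        refine ⟨by rw [hm]; nlinarith, ?_⟩
        have := p.2.2
        simp only [Pi.smul_apply, smul_eq_mul]
        positivity
      have hr : radial (t • (p : Mink)) hc = p := by
        apply Subtype.ext
        funext i
        simp only [radial, hm, neg_neg, Real.sqrt_sq ht.le, Pi.smul_apply, smul_eq_mul]
        field_simp
      simp [radExt, hc, hr]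
    have h5 : HasDerivAt (radExt f ∘ fun t : ℝ => t • (p : Mink)) 0 1 :=
      (hasDerivAt_const (1 : ℝ) (f p)).congr_of_eventuallyEq h4
    exact h3.unique h5
  · simp [diffH2, fderiv_zero_of_not_differentiableAt hd]

theorem gradH2_mem (u : H2 → ℝ) (p : H2) : gradH2 u p ∈ tangentH2 p := by
  change mink p (gradH2 u p) = 0
  have h := mink_gradH2 u p p
  rw [diffH2_self] at h
  rw [← h]
  simp only [mink]
  ring

/-- The almost complex structure of the hyperbolic plane. -/
def rotJ (p : H2) (v : Mink) : Mink := cross p v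

/-- The Levi-Civita covariant derivative of a tangent vector field `W` in the direction `v`:
the tangential part of the derivative in the ambient space. -/
def covDeriv (W : H2 → Mink) (p : H2) : tangentH2 p →ₗ[ℝ] tangentH2 p :=
  (projTangent p).comp ((diffH2 W p).toLinearMap.comp (tangentH2 p).subtype)

/-- The hyperbolic Hessian, as a `(1,1)`-tensor. -/
def hessH2 (u : H2 → ℝ) (p : H2) : tangentH2 p →ₗ[ℝ] tangentH2 p := covDeriv (gradH2 u) p

/-- The Laplace-Beltrami operator of the hyperbolic plane. -/
def laplaceH2 (u : H2 → ℝ) (p : H2) : ℝ := LinearMap.trace ℝ (tangentH2 p) (hessH2 u p)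

/-! The Klein model, with the unit disk seen in `ℂ`. -/

/-- The affine chart `η ↦ (1, η)`. -/
def affinePt (η : ℂ) : Mink := ![1, η.re, η.im]

/-- The radial projection `(x 0, x 1, x 2) ↦ (x 1 / x 0, x 2 / x 0)`. -/
def kleinProj (x : Mink) : ℂ := ⟨x 1 / x 0, x 2 / x 0⟩

/-- The function on the Klein disk associated with a function on the hyperbolic plane: the
restriction to the plane `x 0 = 1` of the extension of `u` that is homogeneous of degree one. -/
def kleinFun (u : H2 → ℝ) (η : ℂ) : ℝ := √(1 - ‖η‖ ^ 2) * radExt u (affinePt η)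

/-- The function on the Klein disk associated with `u` extends continuously by `φ` to the circle;
that is, the boundary at infinity of the graph of `u` is the graph of `φ`. -/
def HasBoundaryValue (u : H2 → ℝ) (φ : Circle → ℝ) : Prop :=
  ∀ z : Circle, Filter.Tendsto (kleinFun u) (nhdsWithin (z : ℂ) (Metric.ball 0 1)) (nhds (φ z))

/-! Surfaces in half-pipe space. The surface `gr u` is lifted to the graph
`p ↦ (p, u p)` in `ℝ³ × ℝ = ℝ⁴`. -/

/-- The vector field along the graph of `u` that lifts a tangent vector field `W`. -/
def graphLift (u : H2 → ℝ) (W : H2 → Mink) : H2 → Mink × ℝ := fun p => (W p, diffH2 u p (W p))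

/-- The half-pipe connection: derivative in the direction of the lift of `v` of a
vector field `Y` along the graph of `u`. It is the flat derivative of `ℝ⁴` minus its component along
the transverse field given by the position vector. -/
def hpDeriv (u : H2 → ℝ) (Y : H2 → Mink × ℝ) (p : H2) (v : tangentH2 p) : Mink × ℝ :=
  diffH2 Y p v - mink v (Y p).1 • ((p : Mink), u p)

/-- `B` is the shape operator at `p` of the graph of `u`: for all tangent fields `W`, the half-pipe
derivative of `W` splits as the lift of its Levi-Civita derivative plus the multiple
`⟨B v, W⟩` (the second fundamental form) of the vertical vector `(0, 1)`. -/
def IsShapeOperator (u : H2 → ℝ) (p : H2) (B : tangentH2 p →ₗ[ℝ] tangentH2 p) : Prop :=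
  ∀ (v : tangentH2 p) (W : H2 → Mink), SmoothOnH2 W → (∀ q : H2, W q ∈ tangentH2 q) →
    hpDeriv u (graphLift u W) p v =
      ((covDeriv W p v : Mink), diffH2 u p (covDeriv W p v)) + mink (B v) (W p) • ((0 : Mink), (1 : ℝ))

/-- The graph of `u` is a smooth mean surface: its shape operator is traceless. -/
def IsMeanGraph (u : H2 → ℝ) : Prop :=
  SmoothOnH2 u ∧ ∀ p : H2, ∃ B : tangentH2 p →ₗ[ℝ] tangentH2 p,
    IsShapeOperator u p B ∧ LinearMap.trace ℝ (tangentH2 p) B = 0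

/-- The mean surface equation. -/
def IsMeanSolution (u : H2 → ℝ) : Prop :=
  SmoothOnH2 u ∧ ∀ p : H2, laplaceH2 u p - 2 * u p = 0

/-- `V` is the vector field associated with the surface `gr u`: its value at `p` is that of
the Killing field `q ↦ cross q σ`, where `σ` is dual to the plane tangent to the surface at
the point over `p`. -/
def IsSurfaceField (u : H2 → ℝ) (V : H2 → Mink) : Prop :=
  ∀ p : H2, ∃ σ : Mink,
    (∀ η ∈ Metric.ball (0 : ℂ) 1, mink (affinePt η) σ =
      kleinFun u (kleinProj p) + fderiv ℝ (kleinFun u) (kleinProj p) (η - kleinProj p)) ∧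
    V p = cross p σ

/-! Spaces of continuous vector fields, with the compact-open topology. -/

/-- Continuous vector fields on the circle. -/
def FieldS1 : Submodule ℝ C(Circle, ℂ) where
  carrier := {X | ∀ z : Circle, inner ℝ (z : ℂ) (X z) = 0}
  add_mem' := by
    intro a b ha hb z
    rw [ContinuousMap.add_apply, inner_add_right, ha z, hb z, add_zero]
  zero_mem' := by intro z; simp
  smul_mem' := by
    intro c a ha z
    rw [ContinuousMap.smul_apply, inner_smul_right, ha z, mul_zero]

/-- Continuous vector fields on the hyperbolic plane. -/
def FieldH2 : Submodule ℝ C(H2, Mink) where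
  carrier := {V | ∀ p : H2, V p ∈ tangentH2 p}
  add_mem' := by
    intro a b ha hb p
    exact (tangentH2 p).add_mem (ha p) (hb p)
  zero_mem' := by intro p; exact (tangentH2 p).zero_mem
  smul_mem' := by
    intro c a ha p
    exact (tangentH2 p).smul_mem c (ha p)

/-- The support function of a vector field on the circle. -/
def supportFun (X : FieldS1) (z : Circle) : ℝ :=
  (X.1 z / (Complex.I * (z : ℂ))).re

theorem eq_supportFun (X : FieldS1) (z : Circle) :
    X.1 z = Complex.I * (z : ℂ) * (supportFun X z : ℂ) := by
  have hz : (z : ℂ) ≠ 0 := Circle.coe_ne_zero z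
  have h1 : Complex.I * (z : ℂ) ≠ 0 := mul_ne_zero Complex.I_ne_zero hz
  have h0 : inner ℝ (z : ℂ) (X.1 z) = 0 := X.2 z
  have him : (X.1 z / (Complex.I * (z : ℂ))).im = 0 := by
    have hc : X.1 z / (Complex.I * (z : ℂ)) = -Complex.I * (X.1 z * star (z : ℂ)) := by
      rw [div_mul_eq_div_div, div_eq_mul_inv, div_eq_mul_inv, Complex.inv_I, ← Circle.coe_inv,
        Circle.coe_inv_eq_conj]
      simp only [Complex.star_def]
      ring
    rw [Complex.inner] at h0
    rw [hc]
    simp at h0 ⊢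
    linarith
  have h2 : ((supportFun X z : ℝ) : ℂ) = X.1 z / (Complex.I * (z : ℂ)) :=
    Complex.ext (by simp [supportFun]) (by simp [him])
  rw [h2, mul_div_cancel₀ _ h1]

/-! The Poincaré disk model. -/

/-- The open unit disk. -/
abbrev B2 := Metric.ball (0 : ℂ) 1

/-- The formula for the isometry `G` from the hyperboloid to the Poincaré disk. -/
def poincare (x : Mink) : ℂ := ⟨x 1 / (1 + x 0), x 2 / (1 + x 0)⟩

/-- The formula for the inverse of `G`. -/
def poincareInv (z : ℂ) : Mink :=
  ![(1 + ‖z‖ ^ 2) / (1 - ‖z‖ ^ 2), 2 * z.re / (1 - ‖z‖ ^ 2), 2 * z.im / (1 - ‖z‖ ^ 2)]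

theorem normSq_eq (z : ℂ) : ‖z‖ ^ 2 = z.re ^ 2 + z.im ^ 2 := by
  rw [← Complex.normSq_eq_norm_sq, Complex.normSq_apply]; ring

/-- The isometry `G`, as a bijection from the hyperboloid onto the Poincaré disk. -/
def poincareEquiv : H2 ≃ B2 where
  toFun p := ⟨poincare p, by
    obtain ⟨p, h1, h2⟩ := p
    simp only [mink] at h1
    rw [mem_ball_zero_iff, ← sq_lt_one_iff₀ (norm_nonneg _), normSq_eq]
    simp only [poincare]
    rw [div_pow, div_pow, ← add_div, div_lt_one (by positivity)]
    nlinarith⟩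
  invFun z := ⟨poincareInv z, by
    obtain ⟨z, hz⟩ := z
    rw [mem_ball_zero_iff, ← sq_lt_one_iff₀ (norm_nonneg _)] at hz
    have hpos : 0 < 1 - ‖z‖ ^ 2 := by linarith
    have hn := normSq_eq z
    refine ⟨?_, ?_⟩
    · simp only [mink, poincareInv, Matrix.cons_val]
      field_simp
      rw [hn]
      ring
    · simp only [poincareInv, Matrix.cons_val]
      positivity⟩
  left_inv := by
    rintro ⟨p, h1, h2⟩
    apply Subtype.ext
    simp only [mink] at h1
    have hq : (1 + p 0) ≠ 0 := by positivity
    have hn : ‖poincare p‖ ^ 2 = (p 0 - 1) / (1 + p 0) := by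
      rw [normSq_eq]
      simp only [poincare]
      field_simp
      linear_combination h1
    have hd : 1 - (p 0 - 1) / (1 + p 0) = 2 / (1 + p 0) := by field_simp; ring
    funext i
    simp only [poincareInv, hn, hd]
    fin_cases i <;> simp [poincare] <;> field_simp
    ring
  right_inv := by
    rintro ⟨z, hz⟩
    apply Subtype.ext
    rw [mem_ball_zero_iff, ← sq_lt_one_iff₀ (norm_nonneg _)] at hz
    have hpos : 1 - ‖z‖ ^ 2 ≠ 0 := by linarith
    have h2 : 1 + (1 + ‖z‖ ^ 2) / (1 - ‖z‖ ^ 2) = 2 / (1 - ‖z‖ ^ 2) := by field_simp; ring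
    apply Complex.ext <;> simp only [poincare, poincareInv, Matrix.cons_val, h2] <;> field_simp

/-- The push-forward by `G` of a vector field on the hyperboloid, as a vector field on the
Poincaré disk. -/
def pushG (V : FieldH2) : B2 → ℂ :=
  fun z => fderiv ℝ poincare (poincareEquiv.symm z : Mink) (V.1 (poincareEquiv.symm z))

/-- The infinitesimal Douady-Earle extension
`z ↦ (1 - |z|²)³ / (2πi) ∫ X(x) / ((1 - z̄ x)³ (x - z)) dx` over the unit circle, written with
`x = exp (iθ)`, `dx = i exp (iθ) dθ`. -/
def douadyEarle (X : FieldS1) : B2 → ℂ := fun z =>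
  ((1 - ‖(z : ℂ)‖ ^ 2 : ℝ) : ℂ) ^ 3 / (2 * Real.pi * Complex.I) *
    ∫ θ in (0 : ℝ)..2 * Real.pi,
      X.1 (Circle.exp θ) /
        ((1 - star (z : ℂ) * (Circle.exp θ : ℂ)) ^ 3 * ((Circle.exp θ : ℂ) - (z : ℂ))) *
      (Complex.I * (Circle.exp θ : ℂ))

end HalfPipe

end

open HalfPipe

open scoped ContDiff

noncomputable section

namespace HalfPipe

/-! Write ℓ(θ) = (1, cos θ, sin θ) for the null vector over a point of the circle. The solution is
given explicitly by the Poisson integral u(p) = (2π)⁻¹ ∫ ⟨p, ℓ⟩⁻² φ dθ (`meanPoisson`). Since ℓ is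
null, the restriction of ⟨x, ℓ⟩^k to the hyperboloid satisfies Δf = k(k+1)f, and k = -2 gives the
eigenvalue 2 (`isMeanSolution_meanPoisson`). In the Klein model the kernel is nonnegative, has total
mass exactly 1 (`conePot_one`) and concentrates at boundary points, so continuous boundary values
are attained (`hasBoundaryValue_meanPoisson`). Uniqueness is a maximum principle with the barrier x₀
+ 1 (`IsMeanSolution.nonpos`).

The shape operator of a graph is Hess u - u·Id, so its trace is Δu - 2u; mean graphs and solutions
of the equation are therefore the same functions (`isMeanGraph_iff`).

The differential of the Klein function is pairing with σ = grad u - u p, which identifies the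
tangent affine function. As p ⊠ p = 0, the associated field p ⊠ σ is J grad u
(`SmoothOnH2.isSurfaceField`). For the Poisson integral this becomes -π⁻¹ ∫ ⟨p, ℓ⟩⁻³ φ (p ⊠ ℓ) dθ,
visibly linear in φ and jointly continuous in the boundary field and p; this is the operator
`meanExtension`.

In the Poincaré disk, with x = exp(iθ), the field p ⊠ ℓ becomes (i/2) x̄ (x - z)² and ⟨p, ℓ⟩ becomes
-|x - z|²/(1 - |z|²). Substitution turns the integrand into that of the Douady–Earle formula
pointwise in θ (`pushG_meanExtension`). -/

/-! The future cone and functions on the hyperbolic plane. -/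

/-- The linear form dual to a vector of Minkowski space. -/
def minkForm (y : Mink) : Mink →L[ℝ] ℝ :=
  -(y 0 • ContinuousLinearMap.proj (R := ℝ) (φ := fun _ : Fin 3 => ℝ) 0)
    + y 1 • ContinuousLinearMap.proj (R := ℝ) (φ := fun _ : Fin 3 => ℝ) 1
    + y 2 • ContinuousLinearMap.proj (R := ℝ) (φ := fun _ : Fin 3 => ℝ) 2

theorem minkForm_apply (y x : Mink) : minkForm y x = mink x y := by
  simp [minkForm, mink]
  ring

theorem mink_comm (x y : Mink) : mink x y = mink y x := by simp only [mink]; ring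

theorem mink_add_left (x y z : Mink) : mink (x + y) z = mink x z + mink y z := by
  simp only [mink, Pi.add_apply]; ring

theorem mink_add_right (x y z : Mink) : mink x (y + z) = mink x y + mink x z := by
  simp only [mink, Pi.add_apply]; ring

theorem mink_sub_left (x y z : Mink) : mink (x - y) z = mink x z - mink y z := by
  simp only [mink, Pi.sub_apply]; ring

theorem mink_smul_left (c : ℝ) (x y : Mink) : mink (c • x) y = c * mink x y := by
  simp only [mink, Pi.smul_apply, smul_eq_mul]; ring

theorem mink_smul_right (c : ℝ) (x y : Mink) : mink x (c • y) = c * mink x y := by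
  simp only [mink, Pi.smul_apply, smul_eq_mul]; ring

theorem contDiff_mink_self : ContDiff ℝ ∞ (fun x : Mink => mink x x) := by
  unfold mink
  fun_prop

theorem hasFDerivAt_mink_self (x : Mink) :
    HasFDerivAt (fun x : Mink => mink x x) ((2 : ℝ) • minkForm x) x := by
  have h (i : Fin 3) : HasFDerivAt (fun x : Mink => x i)
      (ContinuousLinearMap.proj (R := ℝ) (φ := fun _ : Fin 3 => ℝ) i) x :=
    (ContinuousLinearMap.proj (R := ℝ) (φ := fun _ : Fin 3 => ℝ) i).hasFDerivAt
  refine ((((h 0).mul (h 0)).neg.add ((h 1).mul (h 1))).add ((h 2).mul (h 2))).congr_fderiv ?_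
  ext v
  simp [minkForm]
  ring

theorem isOpen_futureCone : IsOpen futureCone :=
  (isOpen_lt contDiff_mink_self.continuous continuous_const).inter
    (isOpen_lt continuous_const (continuous_apply 0))

theorem futureCone_mem_nhds (p : H2) : futureCone ∈ nhds (p : Mink) :=
  isOpen_futureCone.mem_nhds (H2_subset_futureCone p.2)

theorem smul_mem_futureCone {c : ℝ} (hc : 0 < c) {x : Mink} (hx : x ∈ futureCone) :
    c • x ∈ futureCone := by
  refine ⟨?_, mul_pos hc hx.2⟩
  rw [mink_smul_left, mink_smul_right]
  have := hx.1
  have := mul_pos hc hc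
  nlinarith

theorem coe_radial (x : Mink) (hx : x ∈ futureCone) :
    (radial x hx : Mink) = (√(-mink x x))⁻¹ • x := by
  funext i
  simp [radial, div_eq_inv_mul]

theorem radial_smul {c : ℝ} (hc : 0 < c) {x : Mink} (hx : x ∈ futureCone) :
    radial (c • x) (smul_mem_futureCone hc hx) = radial x hx := by
  apply Subtype.ext
  have h : -mink (c • x) (c • x) = c ^ 2 * (-mink x x) := by
    rw [mink_smul_left, mink_smul_right]; ring
  rw [coe_radial, coe_radial, h, Real.sqrt_mul (sq_nonneg c), Real.sqrt_sq hc.le, smul_smul]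
  congr 1
  field_simp

theorem radExt_of_mem {E : Type*} [Zero E] (f : H2 → E) {x : Mink} (hx : x ∈ futureCone) :
    radExt f x = f (radial x hx) := by
  simp [radExt, hx]

theorem radExt_coe {E : Type*} [Zero E] (f : H2 → E) (p : H2) : radExt f p = f p := by
  rw [radExt_of_mem f (H2_subset_futureCone p.2), radial_of_mem_H2]

theorem radExt_smul {E : Type*} [Zero E] (f : H2 → E) {c : ℝ} (hc : 0 < c) (x : Mink) :
    radExt f (c • x) = radExt f x := by
  by_cases hx : x ∈ futureCone
  · rw [radExt_of_mem f hx, radExt_of_mem f (smul_mem_futureCone hc hx), radial_smul hc hx]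
  · have hx' : c • x ∉ futureCone := fun h => hx <| by
      have := smul_mem_futureCone (inv_pos.2 hc) h
      rwa [inv_smul_smul₀ hc.ne'] at this
    simp [radExt, hx, hx']

theorem contDiffOn_sqrt_neg_mink_self :
    ContDiffOn ℝ ∞ (fun x : Mink => √(-mink x x)) futureCone :=
  contDiff_mink_self.neg.contDiffOn.sqrt fun x hx => by have := hx.1; linarith

/-- The radial projection to the hyperbolic plane, as a map to Minkowski space. -/
def toH2 (x : Mink) : Mink := (√(-mink x x))⁻¹ • x

theorem contDiffOn_toH2 : ContDiffOn ℝ ∞ toH2 futureCone := by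
  refine ContDiffOn.smul (contDiffOn_sqrt_neg_mink_self.inv fun x hx => ?_) contDiffOn_id
  have := hx.1
  exact (Real.sqrt_pos.2 (by linarith)).ne'

theorem toH2_mem {x : Mink} (hx : x ∈ futureCone) : toH2 x ∈ H2 := by
  have := (radial x hx).2
  rwa [coe_radial] at this

/-- Differentiating the normalizing factor at a point with ⟨p, p⟩ = -1 yields ⟨p, v⟩p, so the
differential is the orthogonal projection onto the tangent plane. This lets intrinsic differentials
be computed from any ambient formula (`diffH2_comp_coe`). -/
theorem hasFDerivAt_toH2 (p : H2) :
    HasFDerivAt toH2 (ContinuousLinearMap.id ℝ Mink + (minkForm p).smulRight (p : Mink)) p := by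
  have hp := p.2.1
  have h1 := (hasFDerivAt_mink_self (p : Mink)).fun_neg.sqrt (by rw [hp]; norm_num)
  have h2 := (hasDerivAt_inv (x := √(-mink (p : Mink) p)) (by rw [hp]; norm_num)).comp_hasFDerivAt
    (p : Mink) h1
  refine (h2.smul (hasFDerivAt_id (p : Mink))).congr_fderiv ?_
  ext v i
  simp [hp]

theorem radExt_comp_coe {E : Type*} [Zero E] (G : Mink → E) {x : Mink} (hx : x ∈ futureCone) :
    radExt (fun p : H2 => G p) x = G (toH2 x) := by
  rw [radExt_of_mem _ hx, coe_radial, toH2]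

section
variable {E : Type*} [NormedAddCommGroup E] [NormedSpace ℝ E]

theorem smoothOnH2_of_contDiffOn {G : Mink → E} (hG : ContDiffOn ℝ ∞ G futureCone) :
    SmoothOnH2 (fun p : H2 => G p) := by
  have h : ContDiffOn ℝ ∞ (fun x => G (toH2 x)) futureCone :=
    hG.comp contDiffOn_toH2 fun x hx => H2_subset_futureCone (toH2_mem hx)
  exact h.congr fun x hx => radExt_comp_coe G hx

theorem hasFDerivAt_radExt_comp_coe {G : Mink → E} {p : H2} {G' : Mink →L[ℝ] E}
    (hG : HasFDerivAt G G' p) : HasFDerivAt (radExt fun q : H2 => G q)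
      (G'.comp (ContinuousLinearMap.id ℝ Mink + (minkForm p).smulRight (p : Mink))) p := by
  have hp : toH2 p = p := by simp [toH2, p.2.1]
  have h : HasFDerivAt (fun x => G (toH2 x)) _ (p : Mink) :=
    HasFDerivAt.comp (p : Mink) (by rwa [hp]) (hasFDerivAt_toH2 p)
  refine h.congr_of_eventuallyEq ?_
  filter_upwards [futureCone_mem_nhds p] with x hx using radExt_comp_coe G hx

theorem diffH2_comp_coe {G : Mink → E} {p : H2} {G' : Mink →L[ℝ] E}
    (hG : HasFDerivAt G G' p) (v : Mink) :
    diffH2 (fun q : H2 => G q) p v = G' (v + mink p v • (p : Mink)) := by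
  rw [diffH2, (hasFDerivAt_radExt_comp_coe hG).fderiv]
  simp [minkForm_apply, mink_comm v]

theorem SmoothOnH2.differentiableAt {f : H2 → E} (hf : SmoothOnH2 f) (p : H2) :
    DifferentiableAt ℝ (radExt f) (p : Mink) :=
  (hf.contDiffAt (futureCone_mem_nhds p)).differentiableAt (by simp)

theorem SmoothOnH2.hasFDerivAt {f : H2 → E} (hf : SmoothOnH2 f) (p : H2) :
    HasFDerivAt (radExt f) (diffH2 f p) (p : Mink) :=
  (hf.differentiableAt p).hasFDerivAt

theorem SmoothOnH2.grad {u : H2 → ℝ} (hu : SmoothOnH2 u) : SmoothOnH2 (gradH2 u) := by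
  have h := ((contDiffOn_infty_iff_fderiv_of_isOpen isOpen_futureCone).1 hu).2
  have h1 (v : Mink) : ContDiffOn ℝ ∞ (fun x => fderiv ℝ (radExt u) x v) futureCone :=
    h.clm_apply contDiffOn_const
  refine smoothOnH2_of_contDiffOn (G := fun x => ![-fderiv ℝ (radExt u) x (Pi.single 0 1),
    fderiv ℝ (radExt u) x (Pi.single 1 1), fderiv ℝ (radExt u) x (Pi.single 2 1)])
    (contDiffOn_pi.2 fun i => ?_)
  fin_cases i
  · exact (h1 _).neg
  · exact h1 _
  · exact h1 _

end

/-! Integrals of powers of the pairing with the light cone. -/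

open MeasureTheory in
/-- Differentiation under the integral sign for integrands that are continuous together with their
derivative. -/
theorem hasFDerivAt_intervalIntegral_of_continuousOn {H E : Type*} [NormedAddCommGroup H]
    [NormedSpace ℝ H] [ProperSpace H] [NormedAddCommGroup E] [NormedSpace ℝ E]
    {s : Set H} (hs : IsOpen s) {F : H → ℝ → E} {F' : H → ℝ → H →L[ℝ] E}
    (hF : ContinuousOn (fun q : H × ℝ => F q.1 q.2) (s ×ˢ Set.univ))
    (hF' : ContinuousOn (fun q : H × ℝ => F' q.1 q.2) (s ×ˢ Set.univ))
    (hd : ∀ x ∈ s, ∀ t, HasFDerivAt (F · t) (F' x t) x) (a b : ℝ) {x₀ : H} (hx₀ : x₀ ∈ s) :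
    HasFDerivAt (fun x => ∫ t in a..b, F x t) (∫ t in a..b, F' x₀ t) x₀ := by
  obtain ⟨ε, hε, hball⟩ := Metric.isOpen_iff.1 hs x₀ hx₀
  have hsub : Metric.closedBall x₀ (ε / 2) ⊆ s :=
    (Metric.closedBall_subset_ball (by linarith)).trans hball
  have hFx (x : H) (hx : x ∈ s) : Continuous (F x) :=
    hF.comp_continuous (by fun_prop : Continuous fun t : ℝ => (x, t)) fun t => ⟨hx, trivial⟩
  have hFx' : Continuous (F' x₀) :=
    hF'.comp_continuous (by fun_prop : Continuous fun t : ℝ => (x₀, t)) fun t => ⟨hx₀, trivial⟩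
  have hK : IsCompact (Metric.closedBall x₀ (ε / 2) ×ˢ Set.uIcc a b) :=
    (isCompact_closedBall _ _).prod isCompact_uIcc
  obtain ⟨C, hC⟩ := hK.exists_bound_of_continuousOn
    (hF'.mono (Set.prod_mono hsub (Set.subset_univ _)))
  refine intervalIntegral.hasFDerivAt_integral_of_dominated_of_fderiv_le
    (bound := fun _ => C) (F' := F') (Metric.closedBall_mem_nhds x₀ (half_pos hε))
    ?_ ((hFx x₀ hx₀).intervalIntegrable _ _) hFx'.aestronglyMeasurable
    ?_ intervalIntegrable_const ?_
  · filter_upwards [hs.mem_nhds hx₀] with x hx using (hFx x hx).aestronglyMeasurable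
  · exact .of_forall fun t ht x hx => hC (x, t) ⟨hx, Set.uIoc_subset_uIcc ht⟩
  · exact .of_forall fun t _ x hx => hd x (hsub hx) t

/-- The point of the light cone over a point of the circle. -/
def lightPt (θ : ℝ) : Mink := ![1, Real.cos θ, Real.sin θ]

theorem continuous_lightPt : Continuous lightPt := by
  refine continuous_pi fun i => ?_
  fin_cases i
  · exact continuous_const
  · exact Real.continuous_cos
  · exact Real.continuous_sin

theorem mink_lightPt_self (θ : ℝ) : mink (lightPt θ) (lightPt θ) = 0 := by
  have := Real.sin_sq_add_cos_sq θ
  simp [mink, lightPt]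
  linarith

/-- A strict Cauchy–Schwarz inequality on the spatial parts. It makes negative powers of the pairing
smooth on the cone. -/
theorem mink_lightPt_neg {x : Mink} (hx : x ∈ futureCone) (θ : ℝ) : mink x (lightPt θ) < 0 := by
  obtain ⟨h1, h2⟩ := hx
  simp only [mink] at h1
  simp only [mink, lightPt, Matrix.cons_val]
  have h3 := Real.sin_sq_add_cos_sq θ
  have h4 : (x 1 * Real.cos θ + x 2 * Real.sin θ) ^ 2
      = x 1 ^ 2 + x 2 ^ 2 - (x 1 * Real.sin θ - x 2 * Real.cos θ) ^ 2 := by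
    linear_combination (x 1 ^ 2 + x 2 ^ 2) * h3
  have h5 : (x 1 * Real.cos θ + x 2 * Real.sin θ) ^ 2 < x 0 ^ 2 := by
    nlinarith [sq_nonneg (x 1 * Real.sin θ - x 2 * Real.cos θ)]
  have := (abs_lt_of_sq_lt_sq' h5 h2.le).2
  linarith

theorem continuous_minkForm : Continuous minkForm := by
  unfold minkForm
  fun_prop

theorem continuous_mink : Continuous fun q : Mink × Mink => mink q.1 q.2 := by
  unfold mink
  fun_prop

section
variable {E : Type*} [NormedAddCommGroup E] [NormedSpace ℝ E]

/-- The integral over the circle of the `k`-th power of the pairing with the light cone, with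
density `Ψ`. -/
def conePot (k : ℤ) (Ψ : ℝ → E) (x : Mink) : E :=
  ∫ θ in (0 : ℝ)..2 * Real.pi, mink x (lightPt θ) ^ k • Ψ θ

theorem continuousOn_conePot_integrand {E : Type*} [NormedAddCommGroup E] [NormedSpace ℝ E]
    (k : ℤ) {Ψ : ℝ → E} (hΨ : Continuous Ψ) :
    ContinuousOn (fun q : Mink × ℝ => mink q.1 (lightPt q.2) ^ k • Ψ q.2)
      (futureCone ×ˢ Set.univ) := by
  have h1 : Continuous fun q : Mink × ℝ => mink q.1 (lightPt q.2) :=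
    continuous_mink.comp (continuous_fst.prodMk (continuous_lightPt.comp continuous_snd))
  exact (h1.continuousOn.zpow₀ k fun q hq => Or.inl (mink_lightPt_neg hq.1 _).ne).smul
    (hΨ.comp continuous_snd).continuousOn

theorem intervalIntegrable_conePot (k : ℤ) {Ψ : ℝ → E} (hΨ : Continuous Ψ) {x : Mink}
    (hx : x ∈ futureCone) (a b : ℝ) :
    IntervalIntegrable (fun θ => mink x (lightPt θ) ^ k • Ψ θ) MeasureTheory.volume a b :=
  ((continuousOn_conePot_integrand k hΨ).comp_continuous
    (by fun_prop : Continuous fun t : ℝ => (x, t)) fun _ => ⟨hx, trivial⟩).intervalIntegrable _ _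

/-- The density of the derivative of `conePot`. -/
def lightDensity (Ψ : ℝ → E) (θ : ℝ) : Mink →L[ℝ] E := (minkForm (lightPt θ)).smulRight (Ψ θ)

theorem continuous_lightDensity {Ψ : ℝ → E} (hΨ : Continuous Ψ) : Continuous (lightDensity Ψ) := by
  have := continuous_minkForm.comp continuous_lightPt
  exact ((ContinuousLinearMap.smulRightL ℝ Mink E).continuous.comp this).clm_apply hΨ

/-- Differentiation keeps the shape of the integral: the exponent drops by one and the density takes
values in `Mink →L[ℝ] E`. This is why densities are vector-valued. -/
theorem hasFDerivAt_conePot (k : ℤ) {Ψ : ℝ → E} (hΨ : Continuous Ψ) {x : Mink}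
    (hx : x ∈ futureCone) :
    HasFDerivAt (conePot k Ψ) ((k : ℝ) • conePot (k - 1) (lightDensity Ψ) x) x := by
  have h := hasFDerivAt_intervalIntegral_of_continuousOn isOpen_futureCone
    (F := fun x θ => mink x (lightPt θ) ^ k • Ψ θ)
    (F' := fun x θ => (k : ℝ) • mink x (lightPt θ) ^ (k - 1) • lightDensity Ψ θ)
    (continuousOn_conePot_integrand k hΨ)
    ((continuousOn_conePot_integrand (k - 1) (continuous_lightDensity hΨ)).const_smul (k : ℝ))
    (fun x hx θ => ?_) 0 (2 * Real.pi) hx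
  · rwa [intervalIntegral.integral_smul] at h
  · have h1 : HasFDerivAt (fun x => mink x (lightPt θ)) (minkForm (lightPt θ)) x := by
      rw [← show ⇑(minkForm (lightPt θ)) = fun x => mink x (lightPt θ) from
        funext (minkForm_apply _)]
      exact (minkForm (lightPt θ)).hasFDerivAt
    have h2 := (hasDerivAt_zpow k _ (Or.inl (mink_lightPt_neg hx θ).ne)).comp_hasFDerivAt x h1
    refine (h2.smul_const (Ψ θ)).congr_fderiv ?_
    ext v
    simp [lightDensity, smul_smul, mul_assoc]

/-- The target space is quantified inside the induction because each derivative replaces `E` by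
`Mink →L[ℝ] E`. -/
theorem contDiffOn_conePot_nat (n : ℕ) : ∀ {E : Type*} [NormedAddCommGroup E] [NormedSpace ℝ E]
    (k : ℤ) {Ψ : ℝ → E}, Continuous Ψ → ContDiffOn ℝ n (conePot k Ψ) futureCone := by
  induction n with
  | zero =>
    intro E _ _ k Ψ hΨ
    exact contDiffOn_zero.2 fun x hx =>
      (hasFDerivAt_conePot k hΨ hx).continuousAt.continuousWithinAt
  | succ n ih =>
    intro E _ _ k Ψ hΨ
    rw [Nat.cast_succ, contDiffOn_succ_iff_fderiv_of_isOpen isOpen_futureCone]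
    refine ⟨fun x hx => (hasFDerivAt_conePot k hΨ hx).differentiableAt.differentiableWithinAt,
      by simp, ?_⟩
    exact ((ih (k - 1) (continuous_lightDensity hΨ)).const_smul (k : ℝ)).congr fun x hx =>
      (hasFDerivAt_conePot k hΨ hx).fderiv

theorem contDiffOn_conePot (k : ℤ) {Ψ : ℝ → E} (hΨ : Continuous Ψ) :
    ContDiffOn ℝ ∞ (conePot k Ψ) futureCone :=
  contDiffOn_infty.2 fun n => contDiffOn_conePot_nat n k hΨ

theorem conePot_lightDensity_apply (k : ℤ) {Ψ : ℝ → E} (hΨ : Continuous Ψ) {x : Mink}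
    (hx : x ∈ futureCone) (v : Mink) : conePot k (lightDensity Ψ) x v =
      conePot k (fun θ => mink v (lightPt θ) • Ψ θ) x := by
  rw [conePot, ContinuousLinearMap.intervalIntegral_apply
    (intervalIntegrable_conePot k (continuous_lightDensity hΨ) hx _ _), conePot]
  simp [lightDensity, minkForm_apply]

end

/-! The Laplace-Beltrami operator in ambient terms, and the Poisson integral. -/

theorem mink_neg_right (x y : Mink) : mink x (-y) = -mink x y := by
  simp only [mink, Pi.neg_apply]; ring

theorem mink_ext {a b : Mink} (h : ∀ v, mink a v = mink b v) : a = b := by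
  funext i
  fin_cases i
  · simpa [mink] using h (Pi.single 0 1)
  · simpa [mink] using h (Pi.single 1 1)
  · simpa [mink] using h (Pi.single 2 1)

/-- By cyclicity, the trace over the tangent plane equals the trace over Minkowski space of A
composed with v ↦ v + ⟨p, v⟩p. -/
theorem trace_projTangent (p : H2) (A : Mink →ₗ[ℝ] Mink) :
    LinearMap.trace ℝ (tangentH2 p)
      ((projTangent p).comp (A.comp (tangentH2 (p : Mink)).subtype)) =
      ∑ i, A (Pi.single i 1) i + mink p (A p) := by
  rw [LinearMap.trace_comp_comm',
    LinearMap.trace_eq_matrix_trace ℝ (Pi.basisFun ℝ (Fin 3)), Matrix.trace]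
  have h (v : Mink) : (A.comp (tangentH2 (p : Mink)).subtype).comp (projTangent p) v
      = A v + mink p v • A p := by
    simp [projTangent]
  simp only [Matrix.diag_apply, LinearMap.toMatrix_apply, Pi.basisFun_apply, h,
    Pi.basisFun_repr, Pi.add_apply, Pi.smul_apply, smul_eq_mul, Finset.sum_add_distrib]
  congr 1
  simp [Fin.sum_univ_three, mink]

/-- The divergence of a linear vector field. -/
def divL : (Mink →L[ℝ] Mink) →L[ℝ] ℝ :=
  ∑ i, (ContinuousLinearMap.proj (R := ℝ) (φ := fun _ : Fin 3 => ℝ) i).comp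
    (ContinuousLinearMap.apply ℝ Mink (Pi.single i 1 : Mink))

theorem divL_apply (A : Mink →L[ℝ] Mink) : divL A = ∑ i, A (Pi.single i 1) i := by
  simp [divL]

/-- The normal correction in `trace_projTangent` vanishes, since the extension constant on rays has
zero radial derivative. -/
theorem laplaceH2_eq (u : H2 → ℝ) (p : H2) : laplaceH2 u p = divL (diffH2 (gradH2 u) p) := by
  rw [laplaceH2, hessH2, covDeriv, trace_projTangent, divL_apply]
  simp [diffH2_self, mink]

theorem divL_smulRight (y x : Mink) : divL ((minkForm y).smulRight x) = mink y x := by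
  simp [divL_apply, Fin.sum_univ_three, minkForm, mink]

theorem divL_id : divL (ContinuousLinearMap.id ℝ Mink) = 3 := by
  simp [divL_apply]

theorem divL_comp_proj (W : Mink →L[ℝ] Mink) (p : Mink) :
    divL (W.comp (ContinuousLinearMap.id ℝ Mink + (minkForm p).smulRight p)) =
      divL W + mink p (W p) := by
  simp [divL_apply, Fin.sum_univ_three, minkForm, mink]
  ring

section
variable {E F : Type*} [NormedAddCommGroup E] [NormedSpace ℝ E] [NormedAddCommGroup F]
  [NormedSpace ℝ F]

theorem clm_conePot [CompleteSpace E] [CompleteSpace F] (L : E →L[ℝ] F) (k : ℤ) {Ψ : ℝ → E}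
    (hΨ : Continuous Ψ) {x : Mink} (hx : x ∈ futureCone) :
    L (conePot k Ψ x) = conePot k (fun θ => L (Ψ θ)) x := by
  rw [conePot, ← L.intervalIntegral_comp_comm (intervalIntegrable_conePot k hΨ hx _ _)]
  simp [conePot]

/-- This is how Euler's homogeneity relation enters: evaluating a derivative of the integral on x
itself restores one power of the pairing. -/
theorem conePot_pairing (k : ℤ) (Ψ : ℝ → E) {x : Mink} (hx : x ∈ futureCone) :
    conePot k (fun θ => mink x (lightPt θ) • Ψ θ) x = conePot (k + 1) Ψ x := by
  unfold conePot
  congr 1 with θ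
  rw [smul_smul, zpow_add_one₀ (mink_lightPt_neg hx θ).ne]

end

theorem mink_conePot (k : ℤ) {Ψ : ℝ → Mink} (hΨ : Continuous Ψ) {x : Mink} (hx : x ∈ futureCone)
    (v : Mink) : mink (conePot k Ψ x) v = conePot k (fun θ => mink (Ψ θ) v) x := by
  simp only [← minkForm_apply]
  exact clm_conePot (minkForm v) k hΨ hx

/-- The Poisson integral for the mean surface equation. -/
def meanPoisson (φ : ℝ → ℝ) (p : H2) : ℝ := (2 * Real.pi)⁻¹ * conePot (-2) φ p

variable {φ : ℝ → ℝ}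

theorem smoothOnH2_meanPoisson (hφ : Continuous φ) : SmoothOnH2 (meanPoisson φ) :=
  smoothOnH2_of_contDiffOn (G := fun x => (2 * Real.pi)⁻¹ * conePot (-2) φ x)
    (contDiffOn_const.mul (contDiffOn_conePot (-2) hφ))

theorem continuous_smul_lightPt (hφ : Continuous φ) : Continuous fun θ => φ θ • lightPt θ :=
  hφ.smul continuous_lightPt

theorem conePot_lightDensity_eq_mink (k : ℤ) (hφ : Continuous φ) {x : Mink} (hx : x ∈ futureCone)
    (v : Mink) : conePot k (lightDensity φ) x v
      = mink (conePot k (fun θ => φ θ • lightPt θ) x) v := by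
  rw [conePot_lightDensity_apply k hφ hx, mink_conePot k (continuous_smul_lightPt hφ) hx]
  congr 1 with θ
  rw [mink_smul_left, mink_comm, smul_eq_mul, mul_comm]

theorem mink_conePot_self (k : ℤ) (hφ : Continuous φ) {x : Mink} (hx : x ∈ futureCone) :
    mink (conePot k (fun θ => φ θ • lightPt θ) x) x = conePot (k + 1) φ x := by
  rw [mink_conePot k (continuous_smul_lightPt hφ) hx, ← conePot_pairing _ _ hx]
  congr 1 with θ
  rw [mink_smul_left, mink_comm, smul_eq_mul, mul_comm]

/-- The ambient differential is -π⁻¹ times the pairing with the integral of ⟨p, ℓ⟩⁻³ φ ℓ; projecting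
onto the tangent plane adds the multiple of p. -/
theorem gradH2_meanPoisson (hφ : Continuous φ) (p : H2) : gradH2 (meanPoisson φ) p =
    -Real.pi⁻¹ • (conePot (-3) (fun θ => φ θ • lightPt θ) p + conePot (-2) φ p • (p : Mink)) := by
  have hp := H2_subset_futureCone p.2
  have hd := diffH2_comp_coe ((hasFDerivAt_conePot (-2) hφ hp).const_mul (2 * Real.pi)⁻¹)
  have h1 := mink_conePot_self (-3) hφ hp
  refine mink_ext fun v => ?_
  rw [mink_gradH2]
  refine (hd v).trans ?_
  norm_num at h1
  rw [mink_smul_left, mink_add_left, mink_smul_left]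
  norm_num [conePot_lightDensity_eq_mink _ hφ hp]
  rw [mink_add_right, mink_smul_right, h1]
  field_simp

theorem isMeanSolution_meanPoisson (hφ : Continuous φ) : IsMeanSolution (meanPoisson φ) := by
  refine ⟨smoothOnH2_meanPoisson hφ, fun p => ?_⟩
  have hp := H2_subset_futureCone p.2
  have hΨ := continuous_smul_lightPt hφ
  obtain ⟨c, hc⟩ : ∃ c, c = -Real.pi⁻¹ := ⟨_, rfl⟩
  have hW := (((hasFDerivAt_conePot (-3) hΨ hp).add ((hasFDerivAt_conePot (-2) hφ hp).smul
    (hasFDerivAt_id (p : Mink)))).const_smul c)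
  have hg : gradH2 (meanPoisson φ) = fun q : H2 => (c •
      (conePot (-3) (fun θ => φ θ • lightPt θ) + conePot (-2) φ • id) : Mink → Mink) q :=
    funext fun q => by rw [hc]; exact gradH2_meanPoisson hφ q
  -- The divergence of the leading term is an integral against ⟨ℓ, ℓ⟩, which vanishes because ℓ is
  -- null.
  have h4 : divL (conePot (-4) (lightDensity fun θ => φ θ • lightPt θ) (p : Mink)) = 0 := by
    rw [clm_conePot divL _ (continuous_lightDensity hΨ) hp]
    simp [lightDensity, divL_smulRight, mink_smul_right, mink_lightPt_self, conePot]
  have h5 : mink p (conePot (-4) (lightDensity fun θ => φ θ • lightPt θ) (p : Mink) p) =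
      conePot (-2) φ p := by
    rw [conePot_lightDensity_apply _ hΨ hp, conePot_pairing _ _ hp, mink_comm,
      mink_conePot_self _ hφ hp]
    rfl
  have h6 : divL ((conePot (-3) (lightDensity φ) (p : Mink)).smulRight (p : Mink)) =
      conePot (-2) φ p := by
    have := mink_conePot_self (-3) hφ hp
    have h7 : conePot (-3) (lightDensity φ) (p : Mink) =
        minkForm (conePot (-3) (fun θ => φ θ • lightPt θ) (p : Mink)) := by
      ext1 v
      rw [conePot_lightDensity_eq_mink _ hφ hp, minkForm_apply, mink_comm]
    rw [h7, divL_smulRight, this]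
    rfl
  have h8 : conePot (-3) (lightDensity φ) (p : Mink) p = conePot (-2) φ p := by
    rw [conePot_lightDensity_eq_mink _ hφ hp, mink_conePot_self _ hφ hp]
    rfl
  have hpp := p.2.1
  have h9 (a : ℝ) (f : Mink →L[ℝ] ℝ) : (a • f).smulRight (p : Mink) = a • f.smulRight (p : Mink) := by
    ext v i
    simp [mul_assoc]
  -- With I = `conePot (-2) φ p`, the ambient divergence contributes c(0 + 3I - 2I) and the normal
  -- correction c(-3I - I + 2I). The sum -cI equals 2u.
  rw [laplaceH2_eq, diffH2, hg, (hasFDerivAt_radExt_comp_coe hW).fderiv, divL_comp_proj]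
  norm_num [h4, h6, h8, h9, divL_id, mink_smul_right, mink_add_right, mink_neg_right, h5, hpp]
  rw [meanPoisson, hc]
  field_simp
  ring

/-! Shape operators of graphs. -/

/-- The shape operator of the graph of `u`. -/
def shapeOp (u : H2 → ℝ) (p : H2) : tangentH2 p →ₗ[ℝ] tangentH2 p :=
  hessH2 u p + (-u p) • LinearMap.id

theorem trace_shapeOp (u : H2 → ℝ) (p : H2) :
    LinearMap.trace ℝ (tangentH2 p) (shapeOp u p) = laplaceH2 u p - 2 * u p := by
  have h : LinearMap.trace ℝ (tangentH2 (p : Mink)) LinearMap.id = 2 := by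
    have h1 := trace_projTangent p LinearMap.id
    have h2 : (projTangent p).comp (LinearMap.id.comp (tangentH2 (p : Mink)).subtype) =
        LinearMap.id := by
      ext v : 1
      exact projTangent_of_mem p v
    rw [h2] at h1
    rw [h1]
    simp only [LinearMap.id_coe, id_eq, p.2.1]
    norm_num [Fin.sum_univ_three]
  rw [shapeOp, map_add, map_smul, h, laplaceH2, smul_eq_mul]
  ring

theorem hasFDerivAt_mink {H : Type*} [NormedAddCommGroup H] [NormedSpace ℝ H] {f g : H → Mink}
    {f' g' : H →L[ℝ] Mink} {x : H}
    (hf : HasFDerivAt f f' x) (hg : HasFDerivAt g g' x) :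
    HasFDerivAt (fun y => mink (f y) (g y))
      ((minkForm (g x)).comp f' + (minkForm (f x)).comp g') x := by
  have h1 := hasFDerivAt_pi'.1 hf
  have h2 := hasFDerivAt_pi'.1 hg
  refine ((((h1 0).mul (h2 0)).neg.add ((h1 1).mul (h2 1))).add
    ((h1 2).mul (h2 2))).congr_fderiv ?_
  ext v
  simp [minkForm_apply, mink]
  ring

theorem diffH2_mink {V W : H2 → Mink} (hV : SmoothOnH2 V) (hW : SmoothOnH2 W) (p : H2)
    (v : Mink) : diffH2 (fun q => mink (V q) (W q)) p v =
      mink (diffH2 V p v) (W p) + mink (V p) (diffH2 W p v) := by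
  have h := hasFDerivAt_mink (hV.hasFDerivAt p) (hW.hasFDerivAt p)
  have h1 : HasFDerivAt (radExt fun q => mink (V q) (W q)) _ (p : Mink) :=
    h.congr_of_eventuallyEq <| by
      filter_upwards [futureCone_mem_nhds p] with x hx
      simp only [radExt_of_mem _ hx]
  rw [diffH2, h1.fderiv]
  simp [minkForm_apply, radExt_coe, mink_comm]

theorem SmoothOnH2.pairing {V W : H2 → Mink} (hV : SmoothOnH2 V) (hW : SmoothOnH2 W) :
    SmoothOnH2 fun q => mink (V q) (W q) := by
  have h1 := contDiffOn_pi.1 hV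
  have h2 := contDiffOn_pi.1 hW
  have h : ContDiffOn ℝ ∞ (fun x => mink (radExt V x) (radExt W x)) futureCone :=
    (((h1 0).mul (h2 0)).neg.add ((h1 1).mul (h2 1))).add ((h1 2).mul (h2 2))
  exact h.congr fun x hx => by simp only [radExt_of_mem _ hx]

theorem smoothOnH2_coe : SmoothOnH2 (fun q : H2 => (q : Mink)) :=
  smoothOnH2_of_contDiffOn (G := id) contDiffOn_id

theorem diffH2_coe (p : H2) (v : tangentH2 (p : Mink)) : diffH2 (fun q : H2 => (q : Mink)) p v = v := by
  have hv : mink p v = 0 := v.2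
  rw [show (fun q : H2 => (q : Mink)) = fun q : H2 => id (q : Mink) from rfl,
    diffH2_comp_coe (hasFDerivAt_id _)]
  simp [hv]

theorem mink_self_of_tangent {W : H2 → Mink} (hW : SmoothOnH2 W) (ht : ∀ q : H2, W q ∈ tangentH2 q)
    (p : H2) (v : tangentH2 (p : Mink)) : mink p (diffH2 W p v) = -mink v (W p) := by
  have h := diffH2_mink smoothOnH2_coe hW p v
  have h0 : (fun q : H2 => mink q (W q)) = fun q : H2 => (fun _ : Mink => (0 : ℝ)) q :=
    funext ht
  rw [h0, diffH2_comp_coe (hasFDerivAt_const (0 : ℝ) _), diffH2_coe] at h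
  simp at h
  linarith

theorem coe_covDeriv {W : H2 → Mink} (hW : SmoothOnH2 W) (ht : ∀ q : H2, W q ∈ tangentH2 q)
    (p : H2) (v : tangentH2 (p : Mink)) :
    (covDeriv W p v : Mink) = diffH2 W p v - mink v (W p) • (p : Mink) := by
  have h := mink_self_of_tangent hW ht p v
  simp [covDeriv, projTangent, h, sub_eq_add_neg]

theorem SmoothOnH2.prodMk {E F : Type*} [NormedAddCommGroup E] [NormedSpace ℝ E]
    [NormedAddCommGroup F] [NormedSpace ℝ F] {f : H2 → E} {g : H2 → F}
    (hf : SmoothOnH2 f) (hg : SmoothOnH2 g) : SmoothOnH2 fun p => (f p, g p) := by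
  have h : ContDiffOn ℝ ∞ (fun x => (radExt f x, radExt g x)) futureCone := ContDiffOn.prodMk hf hg
  exact h.congr fun x hx => by simp only [radExt_of_mem _ hx]

theorem diffH2_prodMk {E F : Type*} [NormedAddCommGroup E] [NormedSpace ℝ E]
    [NormedAddCommGroup F] [NormedSpace ℝ F] {f : H2 → E} {g : H2 → F}
    (hf : SmoothOnH2 f) (hg : SmoothOnH2 g) (p : H2) (v : Mink) :
    diffH2 (fun p => (f p, g p)) p v = (diffH2 f p v, diffH2 g p v) := by
  have h : HasFDerivAt (radExt fun p => (f p, g p)) _ (p : Mink) :=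
    ((hf.hasFDerivAt p).prodMk (hg.hasFDerivAt p)).congr_of_eventuallyEq <| by
      filter_upwards [futureCone_mem_nhds p] with x hx
      simp only [radExt_of_mem _ hx]
  rw [diffH2, h.fderiv]
  rfl

theorem diffH2_graphLift {u : H2 → ℝ} (hu : SmoothOnH2 u) {W : H2 → Mink} (hW : SmoothOnH2 W)
    (p : H2) (v : Mink) : diffH2 (graphLift u W) p v = (diffH2 W p v,
      mink (diffH2 (gradH2 u) p v) (W p) + mink (gradH2 u p) (diffH2 W p v)) := by
  have h : graphLift u W = fun q => (W q, mink (gradH2 u q) (W q)) := by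
    funext q
    rw [graphLift, mink_gradH2]
  rw [h, diffH2_prodMk hW (hu.grad.pairing hW), diffH2_mink hu.grad hW]

/-- The lift of W has vertical component ⟨grad u, W⟩. Its product rule produces the Hessian, and the
transverse correction produces the term -u⟨v, W⟩. -/
theorem hpDeriv_graphLift {u : H2 → ℝ} (hu : SmoothOnH2 u) {W : H2 → Mink} (hW : SmoothOnH2 W)
    (ht : ∀ q : H2, W q ∈ tangentH2 q) (p : H2) (v : tangentH2 (p : Mink)) :
    hpDeriv u (graphLift u W) p v = ((covDeriv W p v : Mink), diffH2 u p (covDeriv W p v)) +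
      mink (shapeOp u p v) (W p) • ((0 : Mink), (1 : ℝ)) := by
  have hWp : mink p (W p) = 0 := ht p
  rw [hpDeriv, diffH2_graphLift hu hW, coe_covDeriv hW ht]
  ext i
  · simp [graphLift]
  · have h1 : (shapeOp u p v : Mink) =
        diffH2 (gradH2 u) p v - mink v (gradH2 u p) • (p : Mink) + (-u p) • (v : Mink) := by
      rw [← coe_covDeriv hu.grad (gradH2_mem u)]
      rfl
    simp [-neg_smul, graphLift, h1, mink_sub_left, mink_add_left, mink_smul_left, hWp, diffH2_self, mink_gradH2]
    ring

theorem isShapeOperator_shapeOp {u : H2 → ℝ} (hu : SmoothOnH2 u) (p : H2) :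
    IsShapeOperator u p (shapeOp u p) := fun v _ hW ht => hpDeriv_graphLift hu hW ht p v

theorem IsShapeOperator.eq_shapeOp {u : H2 → ℝ} (hu : SmoothOnH2 u) {p : H2}
    {B : tangentH2 (p : Mink) →ₗ[ℝ] tangentH2 (p : Mink)} (hB : IsShapeOperator u p B) :
    B = shapeOp u p := by
  ext1 v
  apply Subtype.ext
  refine mink_ext fun w => ?_
  -- Tangential projections of constant vectors are enough test fields: against the tangent vector B
  -- v, they pair at p as w itself.
  have hW : SmoothOnH2 fun q : H2 => w + mink q w • (q : Mink) := by
    refine smoothOnH2_of_contDiffOn (G := fun x => w + mink x w • x) (ContDiff.contDiffOn ?_)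
    unfold mink
    fun_prop
  have ht (q : H2) : w + mink q w • (q : Mink) ∈ tangentH2 (q : Mink) := (projTangent q w).2
  have h := congrArg Prod.snd ((hB v _ hW ht).symm.trans (hpDeriv_graphLift hu hW ht p v))
  have h1 : mink p (B v) = 0 := (B v).2
  have h2 : mink p (shapeOp u p v) = 0 := (shapeOp u p v).2
  simpa [mink_add_right, mink_smul_right, mink_comm _ (p : Mink), h1, h2] using h

theorem isMeanGraph_iff (u : H2 → ℝ) : IsMeanGraph u ↔ IsMeanSolution u := by
  refine and_congr_right fun hu => forall_congr' fun p => ?_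
  rw [← trace_shapeOp]
  constructor
  · rintro ⟨B, hB, h⟩
    rwa [← hB.eq_shapeOp hu]
  · exact fun h => ⟨_, isShapeOperator_shapeOp hu p, h⟩

/-! The maximum principle. -/

/-- If the second derivative were positive, the point would also be a local minimum, so g would be
locally constant and its second derivative zero. -/
theorem deriv_deriv_nonpos_of_isLocalMax {g : ℝ → ℝ} {a : ℝ} (hg : IsLocalMax g a)
    (hc : ContinuousAt g a) : deriv (deriv g) a ≤ 0 := by
  by_contra! h
  have h1 := isLocalMin_of_deriv_deriv_pos h hg.deriv_eq_zero hc
  have h2 : g =ᶠ[nhds a] fun _ => g a := by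
    filter_upwards [hg, h1] with x h3 h4 using le_antisymm h3 h4
  have h3 : deriv (deriv g) a = 0 := by
    rw [h2.deriv.deriv_eq]
    simp
  exact h.ne' h3

theorem geodesic_mem {p : Mink} (hp : p ∈ H2) {e : Mink} (he : mink p e = 0) (he1 : mink e e = 1)
    (t : ℝ) : Real.cosh t • p + Real.sinh t • e ∈ H2 := by
  have hm : mink (Real.cosh t • p + Real.sinh t • e) (Real.cosh t • p + Real.sinh t • e) = -1 := by
    have := Real.cosh_sq t
    simp only [mink_add_left, mink_add_right, mink_smul_left, mink_smul_right, mink_comm e p, he,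
      he1, hp.1]
    linarith
  refine ⟨hm, ?_⟩
  have h1 := Real.cosh_pos t
  have hp1 := hp.1
  have hp0 := hp.2
  simp only [mink] at hp1 he he1
  -- Lagrange's identity for the spatial parts of p and e, whose Euclidean product is p₀e₀ by
  -- orthogonality.
  have h3 : (e 0) ^ 2 = p 0 ^ 2 - 1 - (p 1 * e 2 - p 2 * e 1) ^ 2 := by
    have h4 : (p 0 * e 0) ^ 2 = (p 1 * e 1 + p 2 * e 2) ^ 2 := by
      rw [show p 0 * e 0 = p 1 * e 1 + p 2 * e 2 by linarith]
    linear_combination h4 + (e 1 ^ 2 + e 2 ^ 2) * hp1 + (p 0 ^ 2 - 1) * he1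
  have h5 : (Real.sinh t * e 0) ^ 2 < (Real.cosh t * p 0) ^ 2 := by
    have h6 := Real.cosh_sq t
    have h7 : (Real.cosh t * p 0) ^ 2 - (Real.sinh t * e 0) ^ 2 =
        p 0 ^ 2 + Real.sinh t ^ 2 * (1 + (p 1 * e 2 - p 2 * e 1) ^ 2) := by
      rw [mul_pow, mul_pow, h6, h3]; ring
    have : 0 ≤ Real.sinh t ^ 2 * (1 + (p 1 * e 2 - p 2 * e 1) ^ 2) := by positivity
    nlinarith
  have h8 := (abs_lt_of_sq_lt_sq' h5 (by positivity)).1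
  simp only [Pi.add_apply, Pi.smul_apply, smul_eq_mul]
  linarith

/-- Restrict v to the geodesic γ(t) = cosh t·p + sinh t·e. Since γ'' = γ, the acceleration at 0 is
p, normal to the gradient, and the second derivative is exactly the Hessian term. -/
theorem mink_hess_nonpos_of_isMax {v : H2 → ℝ} (hv : SmoothOnH2 v) {p : H2}
    (hmax : ∀ q, v q ≤ v p) {e : Mink} (he : mink p e = 0) (he1 : mink e e = 1) :
    mink (diffH2 (gradH2 v) p e) e ≤ 0 := by
  set γ : ℝ → Mink := fun t => Real.cosh t • (p : Mink) + Real.sinh t • e with hγ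
  set γ' : ℝ → Mink := fun t => Real.sinh t • (p : Mink) + Real.cosh t • e with hγ'
  have hmem (t : ℝ) : γ t ∈ H2 := geodesic_mem p.2 he he1 t
  have hd (t : ℝ) : HasDerivAt γ (γ' t) t :=
    ((Real.hasDerivAt_cosh t).smul_const _).add ((Real.hasDerivAt_sinh t).smul_const _)
  have hd' (t : ℝ) : HasDerivAt γ' (γ t) t :=
    ((Real.hasDerivAt_sinh t).smul_const _).add ((Real.hasDerivAt_cosh t).smul_const _)
  have hg (t : ℝ) : HasDerivAt (fun t => radExt v (γ t))
      (mink (radExt (gradH2 v) (γ t)) (γ' t)) t := by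
    have h := (hv.hasFDerivAt ⟨γ t, hmem t⟩).comp_hasDerivAt t (hd t)
    rw [← mink_gradH2, ← radExt_coe (gradH2 v)] at h
    exact h
  have h0 : γ 0 = p := by simp [hγ]
  have h0' : γ' 0 = e := by simp [hγ']
  have hderiv : deriv (fun t => radExt v (γ t)) = fun t => mink (radExt (gradH2 v) (γ t)) (γ' t) :=
    funext fun t => (hg t).deriv
  have hgrad : HasDerivAt (fun t => radExt (gradH2 v) (γ t)) (diffH2 (gradH2 v) p e) 0 := by
    have h := hv.grad.hasFDerivAt p
    rw [← h0] at h
    have h1 := h.comp_hasDerivAt 0 (hd 0)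
    rwa [h0'] at h1
  have hgg : HasDerivAt (fun t => mink (radExt (gradH2 v) (γ t)) (γ' t))
      (mink (diffH2 (gradH2 v) p e) e) 0 := by
    refine (hasFDerivAt_mink hgrad.hasFDerivAt (hd' 0).hasFDerivAt).hasDerivAt.congr_deriv ?_
    have h1 : mink p (gradH2 v p) = 0 := gradH2_mem v p
    simp [minkForm_apply, h0, h0', radExt_coe, h1]
  have hloc : IsLocalMax (fun t => radExt v (γ t)) 0 := .of_forall fun t => by
    have h := hmax ⟨γ t, hmem t⟩
    rw [← radExt_coe v, ← radExt_coe v p] at h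
    simpa only [h0] using h
  have h := deriv_deriv_nonpos_of_isLocalMax hloc (hg 0).continuousAt
  rwa [hderiv, hgg.deriv] at h

/-- The first vector of an orthonormal frame of the hyperbolic plane. -/
def frameA (p : Mink) : Mink := ![p 1, 1 + p 1 ^ 2 / (1 + p 0), p 1 * p 2 / (1 + p 0)]

/-- The second vector of an orthonormal frame of the hyperbolic plane. -/
def frameB (p : Mink) : Mink := ![p 2, p 1 * p 2 / (1 + p 0), 1 + p 2 ^ 2 / (1 + p 0)]

theorem frame_orthonormal {p : Mink} (hp : p ∈ H2) :
    mink p (frameA p) = 0 ∧ mink p (frameB p) = 0 ∧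
      mink (frameA p) (frameA p) = 1 ∧ mink (frameB p) (frameB p) = 1 := by
  obtain ⟨h1, h2⟩ := hp
  simp only [mink] at h1
  have h3 : 1 + p 0 ≠ 0 := by positivity
  refine ⟨?_, ?_, ?_, ?_⟩ <;> simp only [mink, frameA, frameB, Matrix.cons_val] <;> field_simp
  · linear_combination p 1 * h1
  · linear_combination p 2 * h1
  · linear_combination (p 1 ^ 2) * h1
  · linear_combination (p 2 ^ 2) * h1

/-- Completeness of the Lorentz frame p, `frameA p`, `frameB p`: the sum of squares of the two
spacelike vectors, minus that of p, is the inverse metric. -/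
theorem frame_mul_add_frame_mul {p : Mink} (hp : p ∈ H2) (i j : Fin 3) :
    frameA p i * frameA p j + frameB p i * frameB p j =
      p i * p j + if i = j then (if i = 0 then -1 else 1) else 0 := by
  obtain ⟨h1, h2⟩ := hp
  simp only [mink] at h1
  have h3 : 1 + p 0 ≠ 0 := by positivity
  fin_cases i <;> fin_cases j <;> simp [frameA, frameB] <;> field_simp
  · linear_combination h1
  · linear_combination p 1 * h1
  · linear_combination p 2 * h1
  · linear_combination p 1 * h1
  · linear_combination p 1 ^ 2 * h1
  · linear_combination p 1 * p 2 * h1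
  · linear_combination p 2 * h1
  · linear_combination p 1 * p 2 * h1
  · linear_combination p 2 ^ 2 * h1

/-- In the completeness relation the p pᵀ term contributes only through A p, which is zero. -/
theorem divL_eq_frame {p : Mink} (hp : p ∈ H2) (A : Mink →L[ℝ] Mink) (hA : A p = 0) :
    divL A = mink (A (frameA p)) (frameA p) + mink (A (frameB p)) (frameB p) := by
  have hx (x : Mink) : A x = x 0 • A (Pi.single 0 1) + x 1 • A (Pi.single 1 1)
      + x 2 • A (Pi.single 2 1) := by
    conv_lhs => rw [show x = x 0 • (Pi.single 0 1 : Mink) + x 1 • (Pi.single 1 1 : Mink)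
      + x 2 • (Pi.single 2 1 : Mink) by funext i; fin_cases i <;> simp]
    simp only [map_add, map_smul]
  rw [hx] at hA
  have hA' (i : Fin 3) := congrFun hA i
  have hF := frame_mul_add_frame_mul hp
  rw [divL_apply, hx (frameA p), hx (frameB p), Fin.sum_univ_three]
  simp only [Pi.add_apply, Pi.smul_apply, smul_eq_mul, Pi.zero_apply] at hA'
  simp only [mink, Pi.add_apply, Pi.smul_apply, smul_eq_mul]
  generalize A (Pi.single 0 1) = a at *
  generalize A (Pi.single 1 1) = b at *
  generalize A (Pi.single 2 1) = c at *
  have h00 := hF 0 0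
  have h01 := hF 0 1
  have h02 := hF 0 2
  have h11 := hF 1 1
  have h12 := hF 1 2
  have h22 := hF 2 2
  simp at h00 h01 h02 h11 h12 h22
  linear_combination p 0 * hA' 0 - p 1 * hA' 1 - p 2 * hA' 2 + a 0 * h00 + (b 0 - a 1) * h01
    + (c 0 - a 2) * h02 - b 1 * h11 - (c 1 + b 2) * h12 - c 2 * h22

theorem laplaceH2_nonpos_of_isMax {v : H2 → ℝ} (hv : SmoothOnH2 v) {p : H2}
    (hmax : ∀ q, v q ≤ v p) : laplaceH2 v p ≤ 0 := by
  obtain ⟨h1, h2, h3, h4⟩ := frame_orthonormal p.2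
  rw [laplaceH2_eq, divL_eq_frame p.2 _ (diffH2_self _ p)]
  have := mink_hess_nonpos_of_isMax hv hmax h1 h3
  have := mink_hess_nonpos_of_isMax hv hmax h2 h4
  linarith

/-! Linearity of the Laplace-Beltrami operator. -/

theorem SmoothOnH2.add_smul {E : Type*} [NormedAddCommGroup E] [NormedSpace ℝ E] {f g : H2 → E}
    (hf : SmoothOnH2 f) (hg : SmoothOnH2 g) (c : ℝ) : SmoothOnH2 fun p => f p + c • g p := by
  have h : ContDiffOn ℝ ∞ (fun x => radExt f x + c • radExt g x) futureCone :=
    ContDiffOn.add hf (ContDiffOn.const_smul c hg)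
  exact h.congr fun x hx => by simp only [radExt_of_mem _ hx]

theorem diffH2_add_smul {E : Type*} [NormedAddCommGroup E] [NormedSpace ℝ E] {f g : H2 → E}
    (hf : SmoothOnH2 f) (hg : SmoothOnH2 g) (c : ℝ) (p : H2) :
    diffH2 (fun p => f p + c • g p) p = diffH2 f p + c • diffH2 g p := by
  have h : HasFDerivAt (radExt fun p => f p + c • g p) _ (p : Mink) :=
    ((hf.hasFDerivAt p).add ((hg.hasFDerivAt p).const_smul c)).congr_of_eventuallyEq <| by
      filter_upwards [futureCone_mem_nhds p] with x hx
      simp [radExt_of_mem _ hx]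
  rw [diffH2, h.fderiv]

theorem laplaceH2_add_smul {u w : H2 → ℝ} (hu : SmoothOnH2 u) (hw : SmoothOnH2 w) (c : ℝ)
    (p : H2) : laplaceH2 (fun p => u p + c • w p) p = laplaceH2 u p + c * laplaceH2 w p := by
  have h : gradH2 (fun p => u p + c • w p) = fun p => gradH2 u p + c • gradH2 w p := by
    funext q
    refine mink_ext fun v => ?_
    rw [mink_gradH2, diffH2_add_smul hu hw, mink_add_left, mink_smul_left, mink_gradH2,
      mink_gradH2]
    rfl
  rw [laplaceH2_eq, h, diffH2_add_smul hu.grad hw.grad, map_add, map_smul, laplaceH2_eq,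
    laplaceH2_eq, smul_eq_mul]

theorem IsMeanSolution.add_smul {u w : H2 → ℝ} (hu : IsMeanSolution u) (hw : IsMeanSolution w)
    (c : ℝ) : IsMeanSolution fun p => u p + c • w p := by
  refine ⟨hu.1.add_smul hw.1 c, fun p => ?_⟩
  rw [laplaceH2_add_smul hu.1 hw.1]
  change _ - 2 * (u p + c * w p) = 0
  linear_combination hu.2 p + c * hw.2 p

theorem smoothOnH2_height : SmoothOnH2 fun p : H2 => (p : Mink) 0 + 1 :=
  smoothOnH2_of_contDiffOn (G := fun x => x 0 + 1) (ContDiff.contDiffOn (by fun_prop))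

/-- With h = x₀ + 1 this gives Δh - 2h = -2, so h is a positive strict supersolution: the barrier
for uniqueness. -/
theorem laplaceH2_height (p : H2) : laplaceH2 (fun p : H2 => (p : Mink) 0 + 1) p =
    2 * (p : Mink) 0 := by
  have hproj (x : Mink) : HasFDerivAt (fun x : Mink => x 0)
      (ContinuousLinearMap.proj (R := ℝ) (φ := fun _ : Fin 3 => ℝ) 0) x :=
    (ContinuousLinearMap.proj (R := ℝ) (φ := fun _ : Fin 3 => ℝ) 0).hasFDerivAt
  have hg : gradH2 (fun p : H2 => (p : Mink) 0 + 1) =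
      fun q : H2 => (fun x : Mink => x 0 • x - Pi.single 0 1) q := by
    funext q
    refine mink_ext fun v => ?_
    rw [mink_gradH2]
    refine (diffH2_comp_coe ((hproj q).add_const 1) v).trans ?_
    simp [mink]
    ring
  have hW : HasFDerivAt (fun x : Mink => x 0 • x - Pi.single 0 1) _ (p : Mink) :=
    ((hproj p).smul (hasFDerivAt_id (p : Mink))).sub_const (Pi.single 0 1 : Mink)
  have hpp := p.2.1
  rw [laplaceH2_eq, hg, diffH2, (hasFDerivAt_radExt_comp_coe hW).fderiv, divL_comp_proj]
  have h1 : divL ((ContinuousLinearMap.proj (R := ℝ) (φ := fun _ : Fin 3 => ℝ) 0).smulRight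
      (p : Mink)) = (p : Mink) 0 := by
    simp [divL_apply, Fin.sum_univ_three]
  simp [h1, divL_id, mink_add_right, mink_smul_right, hpp]
  ring

/-! The Klein disk. -/

theorem mink_affinePt_self (η : ℂ) : mink (affinePt η) (affinePt η) = -(1 - ‖η‖ ^ 2) := by
  rw [normSq_eq]
  simp [mink, affinePt]
  ring

theorem affinePt_mem {η : ℂ} (hη : η ∈ Metric.ball (0 : ℂ) 1) : affinePt η ∈ futureCone := by
  rw [mem_ball_zero_iff, ← sq_lt_one_iff₀ (norm_nonneg _)] at hη
  exact ⟨by rw [mink_affinePt_self]; linarith, by simp [affinePt]⟩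

theorem affinePt_kleinProj {x : Mink} (hx : x 0 ≠ 0) : affinePt (kleinProj x) = (x 0)⁻¹ • x := by
  funext i
  fin_cases i <;> simp [affinePt, kleinProj, hx, div_eq_inv_mul]

theorem one_sub_norm_kleinProj_sq (p : H2) : 1 - ‖kleinProj p‖ ^ 2 = ((p : Mink) 0)⁻¹ ^ 2 := by
  have h := mink_affinePt_self (kleinProj p)
  rw [affinePt_kleinProj p.2.2.ne', mink_smul_left, mink_smul_right, p.2.1] at h
  linarith

theorem kleinProj_mem (p : H2) : kleinProj p ∈ Metric.ball (0 : ℂ) 1 := by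
  have h := one_sub_norm_kleinProj_sq p
  have hp := p.2.2
  rw [mem_ball_zero_iff, ← sq_lt_one_iff₀ (norm_nonneg _)]
  have : 0 < ((p : Mink) 0)⁻¹ ^ 2 := by positivity
  linarith

theorem sqrt_one_sub_norm_kleinProj_sq (p : H2) :
    √(1 - ‖kleinProj p‖ ^ 2) = ((p : Mink) 0)⁻¹ := by
  rw [one_sub_norm_kleinProj_sq, Real.sqrt_sq (inv_nonneg.2 p.2.2.le)]

theorem kleinFun_kleinProj (u : H2 → ℝ) (p : H2) :
    kleinFun u (kleinProj p) = ((p : Mink) 0)⁻¹ * u p := by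
  rw [kleinFun, sqrt_one_sub_norm_kleinProj_sq, affinePt_kleinProj p.2.2.ne',
    radExt_smul u (inv_pos.2 p.2.2), radExt_coe]

theorem exists_kleinProj_eq {η : ℂ} (hη : η ∈ Metric.ball (0 : ℂ) 1) :
    ∃ p : H2, kleinProj p = η := by
  refine ⟨radial _ (affinePt_mem hη), ?_⟩
  have h1 := (affinePt_mem hη).1
  have h : √(-mink (affinePt η) (affinePt η)) ≠ 0 := (Real.sqrt_pos.2 (by linarith)).ne'
  apply Complex.ext <;> simp only [kleinProj, radial, div_div_div_cancel_right₀ h] <;>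
    simp [affinePt]

theorem contDiff_affinePt : ContDiff ℝ ∞ affinePt := by
  refine contDiff_pi.2 fun i => ?_
  fin_cases i
  · exact contDiff_const
  · exact Complex.reCLM.contDiff
  · exact Complex.imCLM.contDiff

theorem SmoothOnH2.contDiffOn_kleinFun {u : H2 → ℝ} (hu : SmoothOnH2 u) :
    ContDiffOn ℝ ∞ (kleinFun u) (Metric.ball 0 1) := by
  have h1 : ContDiffOn ℝ ∞ (fun η => √(-mink (affinePt η) (affinePt η))) (Metric.ball 0 1) :=
    contDiffOn_sqrt_neg_mink_self.comp contDiff_affinePt.contDiffOn fun η hη => affinePt_mem hη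
  have h2 : ContDiffOn ℝ ∞ (fun η => radExt u (affinePt η)) (Metric.ball 0 1) :=
    hu.comp contDiff_affinePt.contDiffOn fun η hη => affinePt_mem hη
  refine (h1.mul h2).congr fun η _ => ?_
  rw [kleinFun, mink_affinePt_self, neg_neg]

/-! Uniqueness. -/

theorem IsMeanSolution.nonpos {u : H2 → ℝ} (hu : IsMeanSolution u)
    (hb : HasBoundaryValue u fun _ => 0) (p : H2) : u p ≤ 0 := by
  by_contra! hpos
  -- This is u/(x₀ + 1) in Klein coordinates. The value 0 off the open disk matches the boundary
  -- data; as the denominator is at least 1, continuity up to the circle is inherited from `kleinFun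
  -- u`.
  set h : ℂ → ℝ := (Metric.ball (0 : ℂ) 1).indicator
    fun η => kleinFun u η / (1 + √(1 - ‖η‖ ^ 2)) with hh
  have hval (q : H2) : h (kleinProj q) = u q / ((q : Mink) 0 + 1) := by
    rw [hh, Set.indicator_of_mem (kleinProj_mem q), kleinFun_kleinProj,
      sqrt_one_sub_norm_kleinProj_sq]
    have := q.2.2
    field_simp
  have hcont : ContinuousOn h (Metric.closedBall 0 1) := by
    intro η hη
    by_cases hη1 : η ∈ Metric.ball (0 : ℂ) 1
    · have h1 : ContinuousOn (fun η => kleinFun u η / (1 + √(1 - ‖η‖ ^ 2))) (Metric.ball 0 1) :=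
        hu.1.contDiffOn_kleinFun.continuousOn.div (by fun_prop) fun η _ => by positivity
      exact ((h1.continuousAt (Metric.isOpen_ball.mem_nhds hη1)).congr
        (Filter.eventuallyEq_of_mem (Metric.isOpen_ball.mem_nhds hη1)
          fun y hy => by rw [hh, Set.indicator_of_mem hy])).continuousWithinAt
    · have hnorm : ‖η‖ = 1 := by
        rw [mem_closedBall_zero_iff] at hη
        rw [mem_ball_zero_iff] at hη1
        linarith
      have hb' := hb ⟨η, mem_sphere_zero_iff_norm.2 hnorm⟩
      simp only at hb'
      rw [Metric.tendsto_nhdsWithin_nhds] at hb'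
      rw [ContinuousWithinAt, Metric.tendsto_nhdsWithin_nhds, hh, Set.indicator_of_notMem hη1]
      intro ε hε
      obtain ⟨δ, hδ, hδ'⟩ := hb' ε hε
      refine ⟨δ, hδ, fun {y} _ hy => ?_⟩
      by_cases hy1 : y ∈ Metric.ball (0 : ℂ) 1
      · rw [Set.indicator_of_mem hy1]
        refine lt_of_le_of_lt ?_ (hδ' hy1 hy)
        rw [Real.dist_0_eq_abs, Real.dist_0_eq_abs, abs_div]
        have h2 := Real.sqrt_nonneg (1 - ‖y‖ ^ 2)
        exact div_le_self (abs_nonneg _) (by rw [abs_of_pos (by positivity)]; linarith)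
      · rw [Set.indicator_of_notMem hy1, dist_self]
        exact hε
  obtain ⟨η, _, hη⟩ := (isCompact_closedBall (0 : ℂ) 1).exists_isMaxOn
    ⟨0, Metric.mem_closedBall_self zero_le_one⟩ hcont
  have hle (q : H2) : h (kleinProj q) ≤ h η := hη (Metric.ball_subset_closedBall (kleinProj_mem q))
  have hp : 0 < h η := by
    refine lt_of_lt_of_le ?_ (hle p)
    rw [hval]
    have := p.2.2
    positivity
  have hη1 : η ∈ Metric.ball (0 : ℂ) 1 := by
    by_contra hn
    rw [hh, Set.indicator_of_notMem hn] at hp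
    exact lt_irrefl _ hp
  obtain ⟨q, rfl⟩ := exists_kleinProj_eq hη1
  set m := h (kleinProj q)
  have huq : u q + (-m) • ((q : Mink) 0 + 1) = 0 := by
    have := hval q
    have h0 := q.2.2
    rw [smul_eq_mul, show m = u q / ((q : Mink) 0 + 1) from this]
    field_simp
    ring
  have hmax (r : H2) : u r + (-m) • ((r : Mink) 0 + 1) ≤ u q + (-m) • ((q : Mink) 0 + 1) := by
    have h1 := hle r
    have h0 := r.2.2
    rw [hval, div_le_iff₀ (by positivity)] at h1
    rw [huq, smul_eq_mul]
    linarith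
  -- At the maximum u = m(x₀ + 1), hence Δ(u - m(x₀ + 1)) = 2u - 2m x₀ = 2m > 0, a contradiction.
  have hlap := laplaceH2_nonpos_of_isMax (hu.1.add_smul smoothOnH2_height (-m)) hmax
  rw [laplaceH2_add_smul hu.1 smoothOnH2_height, laplaceH2_height] at hlap
  have := hu.2 q
  rw [smul_eq_mul] at huq
  linarith

theorem HasBoundaryValue.add_smul {u w : H2 → ℝ} {φ ψ : Circle → ℝ} (hu : HasBoundaryValue u φ)
    (hw : HasBoundaryValue w ψ) (c : ℝ) :
    HasBoundaryValue (fun p => u p + c • w p) fun z => φ z + c * ψ z := by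
  intro z
  refine ((hu z).add ((hw z).const_mul c)).congr' ?_
  filter_upwards [self_mem_nhdsWithin] with η hη
  simp only [kleinFun, radExt_of_mem _ (affinePt_mem hη), smul_eq_mul]
  ring

theorem IsMeanSolution.unique {u w : H2 → ℝ} {φ : Circle → ℝ} (hu : IsMeanSolution u)
    (hub : HasBoundaryValue u φ) (hw : IsMeanSolution w) (hwb : HasBoundaryValue w φ) :
    u = w := by
  have key {u w : H2 → ℝ} (hu : IsMeanSolution u) (hub : HasBoundaryValue u φ)
      (hw : IsMeanSolution w) (hwb : HasBoundaryValue w φ) (p : H2) : u p ≤ w p := by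
    have h := (hu.add_smul hw (-1)).nonpos (by simpa using hub.add_smul hwb (-1)) p
    rw [smul_eq_mul] at h
    linarith
  exact funext fun p => le_antisymm (key hu hub hw hwb p) (key hw hwb hu hub p)

/-! Boundary values of the Poisson integral. -/

theorem coe_exp (θ : ℝ) : (Circle.exp θ : ℂ) = ⟨Real.cos θ, Real.sin θ⟩ := by
  rw [Circle.coe_exp]
  apply Complex.ext
  · exact Complex.exp_ofReal_mul_I_re θ
  · exact Complex.exp_ofReal_mul_I_im θ

theorem mink_poincareInv_lightPt {z : ℂ} (hz : z ∈ B2) (θ : ℝ) :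
    mink (poincareInv z) (lightPt θ) = -(‖(Circle.exp θ : ℂ) - z‖ ^ 2 / (1 - ‖z‖ ^ 2)) := by
  rw [mem_ball_zero_iff, ← sq_lt_one_iff₀ (norm_nonneg _)] at hz
  have h : 1 - ‖z‖ ^ 2 ≠ 0 := by linarith
  have h1 := normSq_eq z
  have h2 := Real.sin_sq_add_cos_sq θ
  simp only [mink, poincareInv, lightPt, Matrix.cons_val]
  field_simp
  rw [normSq_eq (_ - _), coe_exp]
  simp only [Complex.sub_re, Complex.sub_im]
  linear_combination h2 - h1

theorem one_sub_star_mul_ne_zero {z x : ℂ} (hz : z ∈ B2) (hx : ‖x‖ ≤ 1) : 1 - star z * x ≠ 0 := by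
  intro h
  rw [mem_ball_zero_iff] at hz
  have h1 : star z * x = 1 := (sub_eq_zero.1 h).symm
  have h2 : ‖z‖ * ‖x‖ = 1 := by rw [← norm_star z, ← norm_mul, h1, norm_one]
  nlinarith [norm_nonneg z, norm_nonneg x]

theorem one_sub_star_mul_circle (z : ℂ) (x : Circle) :
    1 - star z * (x : ℂ) = x * star ((x : ℂ) - z) := by
  have h : (x : ℂ) * star (x : ℂ) = 1 := by
    rw [Complex.star_def, Complex.mul_conj, Circle.normSq_coe]; simp
  rw [star_sub, mul_sub, h]
  ring

theorem circle_sub_ne_zero {z : ℂ} (hz : z ∈ B2) (x : Circle) : (x : ℂ) - z ≠ 0 := by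
  intro h
  rw [mem_ball_zero_iff, ← sub_eq_zero.1 h, Circle.norm_coe] at hz
  exact lt_irrefl _ hz

/-- On the circle 1 - z̄x equals x times the conjugate of x - z, so the integral becomes a contour
integral of x/(1 - z̄x)² against (x - z)⁻². Cauchy's formula for the derivative at z evaluates it.
-/
theorem integral_norm_sub_pow {z : ℂ} (hz : z ∈ B2) :
    ∫ θ in (0 : ℝ)..2 * Real.pi, (‖(Circle.exp θ : ℂ) - z‖ ^ 4)⁻¹ =
      2 * Real.pi * ((1 + ‖z‖ ^ 2) / (1 - ‖z‖ ^ 2) ^ 3) := by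
  have hz1 : (1 - ‖z‖ ^ 2) ≠ 0 := by
    rw [mem_ball_zero_iff, ← sq_lt_one_iff₀ (norm_nonneg _)] at hz
    linarith
  have hzz : star z * z = ((‖z‖ ^ 2 : ℝ) : ℂ) := by
    rw [Complex.star_def, mul_comm, Complex.mul_conj, Complex.normSq_eq_norm_sq]
  have hne : (1 : ℂ) - ((‖z‖ ^ 2 : ℝ) : ℂ) ≠ 0 := by exact_mod_cast hz1
  set U : Set ℂ := {x | 1 - star z * x ≠ 0} with hU
  have hUo : IsOpen U := isOpen_ne_fun (by fun_prop) continuous_const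
  have hd (x : ℂ) (hx : x ∈ U) : HasDerivAt (fun x => x / (1 - star z * x) ^ 2)
      ((1 + star z * x) / (1 - star z * x) ^ 3) x := by
    have h1 : HasDerivAt (fun x => 1 - star z * x) (-star z) x := by
      simpa using ((hasDerivAt_id x).const_mul (star z)).const_sub 1
    have h2 := (hasDerivAt_id x).div (h1.pow 2) (pow_ne_zero 2 hx)
    refine h2.congr_deriv ?_
    have hx' : 1 - star z * x ≠ 0 := hx
    simp only [id, Pi.pow_apply, Nat.add_one_sub_one, Nat.cast_ofNat, pow_one]
    field_simp
    ring
  have hc := Complex.two_pi_I_inv_smul_circleIntegral_sub_sq_inv_smul_of_differentiable hUo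
    (c := 0) (R := 1) (w₀ := z)
    (fun x hx => one_sub_star_mul_ne_zero hz (mem_closedBall_zero_iff.1 hx))
    (fun x hx => (hd x hx).differentiableAt.differentiableWithinAt) hz
  rw [(hd z (one_sub_star_mul_ne_zero hz (mem_ball_zero_iff.1 hz).le)).deriv, circleIntegral,
    hzz] at hc
  have hint (θ : ℝ) : deriv (circleMap 0 1) θ • ((circleMap 0 1 θ - z) ^ 2)⁻¹ •
      (circleMap 0 1 θ / (1 - star z * circleMap 0 1 θ) ^ 2) =
      Complex.I * (((‖(Circle.exp θ : ℂ) - z‖ ^ 4)⁻¹ : ℝ) : ℂ) := by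
    have h1 : circleMap 0 1 θ = (Circle.exp θ : ℂ) := by simp [circleMap]
    have h2 : (‖(Circle.exp θ : ℂ) - z‖ ^ 4 : ℂ) =
        ((Circle.exp θ : ℂ) - z) ^ 2 * star ((Circle.exp θ : ℂ) - z) ^ 2 := by
      rw [← mul_pow, Complex.star_def, Complex.mul_conj, Complex.normSq_eq_norm_sq]
      push_cast
      ring
    have h3 := circle_sub_ne_zero hz (Circle.exp θ)
    have h4 : star ((Circle.exp θ : ℂ) - z) ≠ 0 := star_ne_zero.2 h3
    have h5 := Circle.coe_ne_zero (Circle.exp θ)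
    rw [deriv_circleMap, h1, one_sub_star_mul_circle]
    rw [Complex.ofReal_inv, Complex.ofReal_pow, h2, smul_eq_mul, smul_eq_mul]
    field_simp
  simp only [hint] at hc
  rw [intervalIntegral.integral_const_mul, intervalIntegral.integral_ofReal, smul_eq_mul] at hc
  have hpi : (Real.pi : ℂ) ≠ 0 := by exact_mod_cast Real.pi_ne_zero
  have hI := Complex.I_ne_zero
  generalize (∫ θ in (0 : ℝ)..2 * Real.pi, (‖(Circle.exp θ : ℂ) - z‖ ^ 4)⁻¹) = J at hc ⊢
  have hfin : (J : ℂ) =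
      ((2 * Real.pi * ((1 + ‖z‖ ^ 2) / (1 - ‖z‖ ^ 2) ^ 3) : ℝ) : ℂ) := by
    push_cast at hc hne ⊢
    rw [← hc]
    field_simp
  exact_mod_cast hfin

/-- Normalization of the kernel: the Poisson integral of the constant 1 is x₀, whose Klein function
is identically 1. -/
theorem conePot_one (p : H2) : conePot (-2) (fun _ => (1 : ℝ)) p = 2 * Real.pi * (p : Mink) 0 := by
  obtain ⟨z, rfl⟩ := poincareEquiv.symm.surjective p
  have hz := z.2
  have hz1 : (1 - ‖(z : ℂ)‖ ^ 2) ≠ 0 := by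
    rw [mem_ball_zero_iff, ← sq_lt_one_iff₀ (norm_nonneg _)] at hz
    linarith
  have h (θ : ℝ) : mink (poincareInv z) (lightPt θ) ^ (-2 : ℤ) • (1 : ℝ) =
      (1 - ‖(z : ℂ)‖ ^ 2) ^ 2 * (‖(Circle.exp θ : ℂ) - z‖ ^ 4)⁻¹ := by
    have h3 : ‖(Circle.exp θ : ℂ) - z‖ ≠ 0 := norm_ne_zero_iff.2 (circle_sub_ne_zero hz _)
    rw [mink_poincareInv_lightPt hz, zpow_neg, smul_eq_mul, mul_one]
    norm_cast
    rw [neg_sq]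
    field_simp
  change conePot (-2) _ (poincareInv z) = 2 * Real.pi * poincareInv z 0
  simp only [conePot, h]
  rw [intervalIntegral.integral_const_mul, integral_norm_sub_pow hz]
  simp only [poincareInv, Matrix.cons_val]
  field_simp

/-- In Klein coordinates, -⟨(1, η), ℓ⟩ = (|x - η|² + 1 - |η|²)/2 with x = exp(iθ). -/
theorem neg_mink_lightPt (p : H2) (θ : ℝ) :
    (p : Mink) 0 * (‖(Circle.exp θ : ℂ) - kleinProj p‖ ^ 2 / 2) ≤ -mink p (lightPt θ) := by
  have h1 := mem_ball_zero_iff.1 (kleinProj_mem p)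
  rw [← sq_lt_one_iff₀ (norm_nonneg _), normSq_eq] at h1
  have h2 := Real.sin_sq_add_cos_sq θ
  have h3 : mink p (lightPt θ) = (p : Mink) 0 * mink (affinePt (kleinProj p)) (lightPt θ) := by
    rw [affinePt_kleinProj p.2.2.ne', mink_smul_left, mul_inv_cancel_left₀ p.2.2.ne']
  rw [h3, ← mul_neg]
  refine mul_le_mul_of_nonneg_left ?_ p.2.2.le
  rw [normSq_eq, coe_exp]
  simp only [mink, affinePt, lightPt, Matrix.cons_val, Complex.sub_re, Complex.sub_im]
  nlinarith

/-- An approximate-identity argument: near z the oscillation of φ is small, and away from z the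
kernel is O(x₀⁻²) with x₀⁻² = 1 - |η|² tending to 0. -/
theorem hasBoundaryValue_meanPoisson {φ : Circle → ℝ} (hφ : Continuous φ) :
    HasBoundaryValue (meanPoisson fun θ => φ (Circle.exp θ)) φ := by
  intro z
  obtain ⟨M, hM⟩ := (isCompact_univ (X := Circle)).exists_bound_of_continuousOn hφ.continuousOn
  have hψ : Continuous fun θ => φ (Circle.exp θ) := hφ.comp Circle.exp.continuous
  have hM0 : 0 ≤ M := (norm_nonneg _).trans (hM z trivial)
  rw [Metric.tendsto_nhds]
  intro ε hε
  obtain ⟨δ, hδ, hδφ⟩ := Metric.continuousAt_iff.1 hφ.continuousAt (ε / 2) (half_pos hε)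
  -- 2M bounds the oscillation of φ. If x is δ-far from z and η is within δ/2 of z, then |x - η| ≥
  -- δ/2, so `neg_mink_lightPt` gives the factor δ²/8.
  set C := 2 * M * (δ ^ 2 / 8)⁻¹ ^ 2 with hC
  have hlim : Filter.Tendsto (fun η : ℂ => (1 - ‖η‖ ^ 2) * C) (nhdsWithin z (Metric.ball 0 1))
      (nhds 0) := by
    have h : Continuous fun η : ℂ => (1 - ‖η‖ ^ 2) * C := by fun_prop
    have := h.tendsto (z : ℂ)
    simp only [Circle.norm_coe, one_pow, sub_self, zero_mul] at this
    exact this.mono_left nhdsWithin_le_nhds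
  filter_upwards [self_mem_nhdsWithin, hlim.eventually (gt_mem_nhds (half_pos hε)),
    nhdsWithin_le_nhds (Metric.ball_mem_nhds (z : ℂ) (half_pos hδ))] with η hη hη1 hη2
  obtain ⟨p, rfl⟩ := exists_kleinProj_eq hη
  have hp := H2_subset_futureCone p.2
  have hp0 := p.2.2
  have hp1 : 1 ≤ (p : Mink) 0 := by
    have := p.2.1
    simp only [mink] at this
    nlinarith [sq_nonneg ((p : Mink) 1), sq_nonneg ((p : Mink) 2)]
  have hone := conePot_one p
  have hi (f : ℝ → ℝ) (hf : Continuous f) := intervalIntegrable_conePot (-2) hf hp 0 (2 * Real.pi)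
  have hdiff : conePot (-2) (fun θ => φ (Circle.exp θ)) p - φ z * conePot (-2) (fun _ => (1 : ℝ)) p
      = ∫ θ in (0 : ℝ)..2 * Real.pi, mink p (lightPt θ) ^ (-2 : ℤ) * (φ (Circle.exp θ) - φ z) := by
    rw [conePot, conePot, ← intervalIntegral.integral_const_mul, ← intervalIntegral.integral_sub
      (hi _ hψ) ((hi _ continuous_const).const_mul _)]
    congr 1 with θ
    simp only [smul_eq_mul]
    ring
  have hbound (θ : ℝ) : ‖mink p (lightPt θ) ^ (-2 : ℤ) * (φ (Circle.exp θ) - φ z)‖ ≤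
      ε / 2 * (mink p (lightPt θ) ^ (-2 : ℤ) • (1 : ℝ)) + ((p : Mink) 0)⁻¹ ^ 2 * C := by
    have hk : 0 < mink p (lightPt θ) ^ (-2 : ℤ) := by
      have := mink_lightPt_neg hp θ
      exact Even.zpow_pos ⟨-1, rfl⟩ this.ne
    rw [norm_mul, Real.norm_of_nonneg hk.le, smul_eq_mul, mul_one]
    by_cases hd : dist (Circle.exp θ) z < δ
    · have h1 := (hδφ hd).le
      rw [dist_eq_norm] at h1
      have : 0 ≤ ((p : Mink) 0)⁻¹ ^ 2 * C := by positivity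
      nlinarith
    · have h1 : δ / 2 ≤ ‖(Circle.exp θ : ℂ) - kleinProj p‖ := by
        rw [← dist_eq_norm]
        have h2 := dist_triangle (Circle.exp θ : ℂ) (kleinProj p) z
        rw [Metric.mem_ball] at hη2
        have h3 : dist (Circle.exp θ : ℂ) z = dist (Circle.exp θ) z := rfl
        linarith
      have h2 : (p : Mink) 0 * (δ ^ 2 / 8) ≤ -mink p (lightPt θ) :=
        le_trans (mul_le_mul_of_nonneg_left (by nlinarith) hp0.le) (neg_mink_lightPt p θ)
      have h3 : mink p (lightPt θ) ^ (-2 : ℤ) ≤ (((p : Mink) 0 * (δ ^ 2 / 8)) ^ 2)⁻¹ := by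
        have h9 : mink p (lightPt θ) ^ (-2 : ℤ) = ((-mink p (lightPt θ)) ^ 2)⁻¹ := by
          rw [zpow_neg, neg_sq]
          norm_cast
        rw [h9]
        exact inv_anti₀ (by positivity) (pow_le_pow_left₀ (by positivity) h2 2)
      have h4 : ‖φ (Circle.exp θ) - φ z‖ ≤ 2 * M := by
        have := norm_sub_le (φ (Circle.exp θ)) (φ z)
        linarith [hM (Circle.exp θ) trivial, hM z trivial]
      have h5 := mul_le_mul h3 h4 (norm_nonneg _) (by positivity)
      have h6 : (((p : Mink) 0 * (δ ^ 2 / 8)) ^ 2)⁻¹ * (2 * M) = ((p : Mink) 0)⁻¹ ^ 2 * C := by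
        rw [hC, mul_pow, mul_inv, inv_pow, inv_pow]
        ring
      have h7 : 0 ≤ ε / 2 * mink p (lightPt θ) ^ (-2 : ℤ) := by positivity
      linarith
  have hI := intervalIntegral.norm_integral_le_of_norm_le (by positivity : 0 ≤ 2 * Real.pi)
    (.of_forall fun θ _ => hbound θ)
    (((hi _ continuous_const).const_mul _).add intervalIntegrable_const)
  rw [intervalIntegral.integral_add ((hi _ continuous_const).const_mul _) intervalIntegrable_const,
    intervalIntegral.integral_const_mul, intervalIntegral.integral_const, ← hdiff] at hI
  change _ ≤ ε / 2 * conePot (-2) (fun _ => (1 : ℝ)) p + _ at hI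
  rw [hone, sub_zero, smul_eq_mul, ← one_sub_norm_kleinProj_sq] at hI
  rw [dist_eq_norm, kleinFun_kleinProj, meanPoisson]
  have hA : 0 < 2 * Real.pi * (p : Mink) 0 := by positivity
  -- Since x₀ ≥ 1, the far contribution 2π(1 - |η|²)C is less than (ε/2)·2πx₀.
  have hA1 : 2 * Real.pi ≤ 2 * Real.pi * (p : Mink) 0 := le_mul_of_one_le_right (by positivity) hp1
  have hfac : ((p : Mink) 0)⁻¹ * ((2 * Real.pi)⁻¹ * conePot (-2) (fun θ => φ (Circle.exp θ)) p) - φ z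
      = (2 * Real.pi * (p : Mink) 0)⁻¹ * (conePot (-2) (fun θ => φ (Circle.exp θ)) p
        - φ z * (2 * Real.pi * (p : Mink) 0)) := by
    field_simp
  rw [hfac, norm_mul, norm_inv, Real.norm_of_nonneg hA.le, inv_mul_lt_iff₀ hA]
  have hpos : 0 ≤ (1 - ‖kleinProj p‖ ^ 2) * C := by
    rw [one_sub_norm_kleinProj_sq]; positivity
  nlinarith

/-! The vector field associated with a surface. -/

/-- The extension is homogeneous of degree 0, so its derivative is homogeneous of degree -1; this
moves base points from the hyperboloid to the plane x₀ = 1. -/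
theorem diffH2_eq_smul_fderiv (u : H2 → ℝ) (p : H2) :
    diffH2 u p = ((p : Mink) 0)⁻¹ • fderiv ℝ (radExt u) (((p : Mink) 0)⁻¹ • (p : Mink)) := by
  rw [← fderiv_comp_smul, diffH2]
  congr 1
  exact (funext fun x => radExt_smul u (inv_pos.2 p.2.2) x).symm

/-- The linear part of `affinePt`. -/
def affineL : ℂ →L[ℝ] Mink := ContinuousLinearMap.pi ![0, Complex.reCLM, Complex.imCLM]

theorem affinePt_sub (η ζ : ℂ) : affinePt η - affinePt ζ = affineL (η - ζ) := by
  funext i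
  fin_cases i <;> simp [affinePt, affineL]

theorem hasFDerivAt_affinePt (η : ℂ) : HasFDerivAt affinePt affineL η := by
  have h : affinePt = fun ζ => affineL ζ + affinePt 0 := by
    funext ζ
    rw [← sub_eq_iff_eq_add, affinePt_sub, sub_zero]
  rw [h]
  exact affineL.hasFDerivAt.add_const _

/-- `kleinFun u` restricts √(-⟨x, x⟩) times the ray extension of u to the plane x₀ = 1. The root
contributes -u p to the dual vector, the extension contributes grad u. -/
theorem SmoothOnH2.fderiv_kleinFun {u : H2 → ℝ} (hu : SmoothOnH2 u) (p : H2) (w : ℂ) :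
    fderiv ℝ (kleinFun u) (kleinProj p) w =
      mink (gradH2 u p - u p • (p : Mink)) (affineL w) := by
  have hp0 := p.2.2
  set x₀ := affinePt (kleinProj p) with hx₀
  have hx₀' : x₀ = ((p : Mink) 0)⁻¹ • (p : Mink) := affinePt_kleinProj p.2.2.ne'
  have hm : mink x₀ x₀ = -((p : Mink) 0)⁻¹ ^ 2 := by
    rw [hx₀, mink_affinePt_self, one_sub_norm_kleinProj_sq]
  have hmem : x₀ ∈ futureCone := affinePt_mem (kleinProj_mem p)
  have h1 : HasFDerivAt (fun x : Mink => √(-mink x x)) _ x₀ :=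
    (hasFDerivAt_mink_self x₀).fun_neg.sqrt (neg_ne_zero.2 hmem.1.ne)
  have h2 : HasFDerivAt (radExt u) (fderiv ℝ (radExt u) x₀) x₀ :=
    ((hu.contDiffAt (isOpen_futureCone.mem_nhds hmem)).differentiableAt (by simp)).hasFDerivAt
  have h3 := (h1.mul h2).comp (kleinProj p) (hasFDerivAt_affinePt (kleinProj p))
  have h4 : HasFDerivAt (kleinFun u) _ (kleinProj p) := h3.congr_of_eventuallyEq
    (.of_forall fun η => by simp [kleinFun, mink_affinePt_self])
  have h5 : radExt u x₀ = u p := by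
    rw [hx₀', radExt_smul u (inv_pos.2 hp0), radExt_coe]
  have h6 (v : Mink) : ((p : Mink) 0)⁻¹ * fderiv ℝ (radExt u) x₀ v = mink (gradH2 u p) v := by
    rw [mink_gradH2, diffH2_eq_smul_fderiv, hx₀']
    rfl
  have h7 : √(((p : Mink) 0)⁻¹ ^ 2) = ((p : Mink) 0)⁻¹ := Real.sqrt_sq (inv_nonneg.2 hp0.le)
  rw [h4.fderiv, mink_sub_left, mink_smul_left, ← h6]
  simp only [ContinuousLinearMap.comp_apply, add_apply, smul_apply, neg_apply, smul_eq_mul, hm,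
    neg_neg, h7, h5, minkForm_apply]
  rw [hx₀', mink_smul_right, mink_comm _ (p : Mink)]
  field_simp
  ring

theorem cross_self (p : Mink) : cross p p = 0 := by
  funext i
  fin_cases i <;> simp [cross] <;> ring

/-- The Minkowski cross product with a fixed vector. -/
def crossL (p : Mink) : Mink →L[ℝ] Mink := LinearMap.toContinuousLinearMap
  { toFun := cross p
    map_add' := fun a b => by
      funext i
      fin_cases i <;> simp [cross] <;> ring
    map_smul' := fun c a => by
      funext i
      fin_cases i <;> simp [cross] <;> ring }

theorem crossL_apply (p v : Mink) : crossL p v = cross p v := rfl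

theorem mink_cross_self (p v : Mink) : mink p (cross p v) = 0 := by
  simp only [mink, cross, Matrix.cons_val]
  ring

/-- The dual vector is σ = grad u - u p; the cross product with p discards its normal part. -/
theorem SmoothOnH2.isSurfaceField {u : H2 → ℝ} (hu : SmoothOnH2 u) :
    IsSurfaceField u fun p => rotJ p (gradH2 u p) := by
  intro p
  refine ⟨gradH2 u p - u p • (p : Mink), fun η _ => ?_, ?_⟩
  · have h : mink (gradH2 u p) p = 0 := by rw [mink_comm]; exact gradH2_mem u p
    have h1 : mink (gradH2 u p - u p • (p : Mink)) (affinePt (kleinProj p)) =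
        ((p : Mink) 0)⁻¹ * u p := by
      rw [affinePt_kleinProj p.2.2.ne', mink_smul_right, mink_sub_left, mink_smul_left, h, p.2.1]
      ring
    rw [hu.fderiv_kleinFun, ← affinePt_sub, kleinFun_kleinProj, ← h1, ← mink_add_right, mink_comm]
    congr 1
    abel
  · change cross p (gradH2 u p) = _
    rw [← crossL_apply, ← crossL_apply, map_sub, map_smul, crossL_apply p p, cross_self,
      smul_zero, sub_zero]

/-! The linear operator. -/

theorem continuous_supportFun : Continuous fun q : FieldS1 × Circle => supportFun q.1 q.2 := by
  have h : Continuous fun q : FieldS1 × Circle => q.1.1 q.2 :=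
    (continuous_subtype_val.comp continuous_fst).eval continuous_snd
  have h2 : Continuous fun q : FieldS1 × Circle => Complex.I * (q.2 : ℂ) := by fun_prop
  exact Complex.continuous_re.comp
    (h.div h2 fun q => mul_ne_zero Complex.I_ne_zero (Circle.coe_ne_zero _))

theorem continuous_supportFun_right (X : FieldS1) : Continuous (supportFun X) :=
  continuous_supportFun.comp (by fun_prop : Continuous fun z : Circle => (X, z))

theorem continuous_supportFun_exp (X : FieldS1) :
    Continuous fun θ => supportFun X (Circle.exp θ) :=
  (continuous_supportFun_right X).comp Circle.exp.continuous

/-- The integral formula for the vector field associated with the mean surface. -/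
def meanField (X : FieldS1) (p : Mink) : Mink :=
  -Real.pi⁻¹ • cross p (conePot (-3) (fun θ => supportFun X (Circle.exp θ) • lightPt θ) p)

theorem meanField_eq (X : FieldS1) (p : H2) : meanField X p =
    rotJ p (gradH2 (meanPoisson fun θ => supportFun X (Circle.exp θ)) p) := by
  rw [gradH2_meanPoisson (continuous_supportFun_exp X), rotJ, ← crossL_apply, map_smul, map_add,
    map_smul, crossL_apply p p, cross_self, smul_zero, add_zero]
  rfl

theorem continuous_meanField : Continuous fun q : FieldS1 × H2 => meanField q.1 q.2 := by
  have h1 : Continuous fun q : (FieldS1 × H2) × ℝ =>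
      mink q.1.2 (lightPt q.2) ^ (-3 : ℤ) • supportFun q.1.1 (Circle.exp q.2) • lightPt q.2 := by
    have hl : Continuous fun q : (FieldS1 × H2) × ℝ => lightPt q.2 :=
      continuous_lightPt.comp continuous_snd
    have hm : Continuous fun q : (FieldS1 × H2) × ℝ => mink q.1.2 (lightPt q.2) :=
      continuous_mink.comp ((continuous_subtype_val.comp (by fun_prop)).prodMk hl)
    have hs : Continuous fun q : (FieldS1 × H2) × ℝ => supportFun q.1.1 (Circle.exp q.2) :=
      continuous_supportFun.comp ((by fun_prop : Continuous fun q : (FieldS1 × H2) × ℝ =>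
        q.1.1).prodMk (Circle.exp.continuous.comp continuous_snd))
    exact (hm.zpow₀ _ fun q => Or.inl
      (mink_lightPt_neg (H2_subset_futureCone q.1.2.2) _).ne).smul (hs.smul hl)
  have h2 := intervalIntegral.continuous_parametric_intervalIntegral_of_continuous'
    (μ := MeasureTheory.volume) (f := fun (q : FieldS1 × H2) θ =>
      mink q.2 (lightPt θ) ^ (-3 : ℤ) • supportFun q.1 (Circle.exp θ) • lightPt θ) h1 0 (2 * Real.pi)
  have hc : Continuous fun q : Mink × Mink => cross q.1 q.2 := by
    refine continuous_pi fun i => ?_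
    fin_cases i <;> simp only [cross, Fin.zero_eta, Fin.mk_one, Fin.reduceFinMk,
      Matrix.cons_val] <;> fun_prop
  exact (hc.comp ((continuous_subtype_val.comp continuous_snd).prodMk h2)).const_smul (-Real.pi⁻¹)

theorem supportFun_add (X Y : FieldS1) (z : Circle) :
    supportFun (X + Y) z = supportFun X z + supportFun Y z := by
  simp [supportFun, add_div]

theorem supportFun_smul (c : ℝ) (X : FieldS1) (z : Circle) :
    supportFun (c • X) z = c * supportFun X z := by
  simp [supportFun, mul_div_assoc]

theorem meanField_add (X Y : FieldS1) (p : H2) :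
    meanField (X + Y) p = meanField X p + meanField Y p := by
  have hi (X : FieldS1) := intervalIntegrable_conePot (-3)
    (continuous_smul_lightPt (continuous_supportFun_exp X)) (H2_subset_futureCone p.2)
    0 (2 * Real.pi)
  simp only [meanField, conePot, supportFun_add, add_smul, smul_add]
  rw [intervalIntegral.integral_add (hi X) (hi Y), ← crossL_apply, map_add, smul_add]
  rfl

theorem meanField_smul (c : ℝ) (X : FieldS1) (p : H2) :
    meanField (c • X) p = c • meanField X p := by
  simp only [meanField, conePot, supportFun_smul, mul_smul]
  simp only [smul_comm _ c, intervalIntegral.integral_smul]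
  rw [← crossL_apply, map_smul, smul_comm]
  rfl

/-- The continuous linear operator that extends vector fields on the circle to the hyperbolic plane
by the fields associated with mean surfaces. -/
def meanExtension : FieldS1 →L[ℝ] FieldH2 where
  toFun X := ⟨⟨fun p => meanField X p, continuous_meanField.comp
      (by fun_prop : Continuous fun p : H2 => (X, p))⟩, fun p => by
    change mink p (meanField X p) = 0
    rw [meanField, mink_smul_right, mink_cross_self, mul_zero]⟩
  map_add' X Y := by
    ext p : 2
    exact meanField_add X Y p
  map_smul' c X := by
    ext p : 2
    exact meanField_smul c X p
  -- Joint continuity in the boundary field and the point curries to continuity for the compact-open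
  -- topology.
  cont := (ContinuousMap.continuous_of_continuous_uncurry _ continuous_meanField).subtype_mk _

/-! The Poincaré disk. -/

theorem fderiv_poincare {x : Mink} (hx : 1 + x 0 ≠ 0) (v : Mink) :
    fderiv ℝ poincare x v = (⟨v 1, v 2⟩ - v 0 * poincare x) / ((1 + x 0 : ℝ) : ℂ) := by
  have hpr (i : Fin 3) : HasFDerivAt (fun x : Mink => x i)
      (ContinuousLinearMap.proj (R := ℝ) (φ := fun _ : Fin 3 => ℝ) i) x :=
    (ContinuousLinearMap.proj (R := ℝ) (φ := fun _ : Fin 3 => ℝ) i).hasFDerivAt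
  have hd (i : Fin 3) := (hpr i).mul ((hasDerivAt_inv hx).comp_hasFDerivAt x ((hpr 0).const_add 1))
  have h : HasFDerivAt poincare _ x :=
    (Complex.equivRealProdCLM.symm.toContinuousLinearMap.hasFDerivAt.comp x
      ((hd 1).prodMk (hd 2))).congr_of_eventuallyEq <| .of_forall fun y => by
        apply Complex.ext <;> simp [poincare, div_eq_mul_inv]
  rw [h.fderiv]
  apply Complex.ext <;> simp [poincare, Complex.div_re, Complex.div_im, Complex.normSq_apply] <;>
    field_simp <;> ring

/-- The field p ⊠ ℓ is the parabolic Killing field fixing the ideal point x, so in the disk it is a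
quadratic polynomial in z with a double zero at x. -/
theorem fderiv_poincare_cross {z : ℂ} (hz : z ∈ B2) (θ : ℝ) :
    fderiv ℝ poincare (poincareInv z) (cross (poincareInv z) (lightPt θ)) =
      Complex.I / 2 * star (Circle.exp θ : ℂ) * ((Circle.exp θ : ℂ) - z) ^ 2 := by
  have hright : poincare (poincareInv z) = z :=
    congrArg Subtype.val (poincareEquiv.apply_symm_apply ⟨z, hz⟩)
  rw [mem_ball_zero_iff, ← sq_lt_one_iff₀ (norm_nonneg _)] at hz
  have hz1 : 1 - ‖z‖ ^ 2 ≠ 0 := by linarith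
  have h0 : 1 + poincareInv z 0 = 2 / (1 - ‖z‖ ^ 2) := by
    simp only [poincareInv, Matrix.cons_val]
    field_simp
    ring
  rw [fderiv_poincare (by rw [h0]; positivity), hright, h0, coe_exp]
  have hn := normSq_eq z
  have hcs := Real.sin_sq_add_cos_sq θ
  obtain ⟨a, b⟩ := z
  have hne : ((2 / (1 - ‖(⟨a, b⟩ : ℂ)‖ ^ 2) : ℝ) : ℂ) ≠ 0 :=
    Complex.ofReal_ne_zero.2 (div_ne_zero two_ne_zero hz1)
  rw [div_eq_iff hne]
  simp only [cross, poincareInv, lightPt, Matrix.cons_val] at hn ⊢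
  generalize Real.cos θ = c at *
  generalize Real.sin θ = d at *
  generalize ‖(⟨a, b⟩ : ℂ)‖ ^ 2 = n at *
  -- Naming the quotients allows clearing denominators separately, leaving polynomial identities
  -- modulo c² + d² = 1.
  obtain ⟨t, ht⟩ : ∃ t, t = 2 / (1 - n) := ⟨_, rfl⟩
  obtain ⟨v₀, hv₀⟩ : ∃ v, v = 2 * b / (1 - n) * c - 2 * a / (1 - n) * d := ⟨_, rfl⟩
  obtain ⟨v₁, hv₁⟩ : ∃ v, v = 2 * b / (1 - n) * 1 - (1 + n) / (1 - n) * d := ⟨_, rfl⟩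
  obtain ⟨v₂, hv₂⟩ : ∃ v, v = (1 + n) / (1 - n) * c - 2 * a / (1 - n) * 1 := ⟨_, rfl⟩
  rw [← ht, ← hv₀, ← hv₁, ← hv₂]
  field_simp at ht hv₀ hv₁ hv₂
  subst hn
  apply Complex.ext <;> refine mul_left_cancel₀ hz1 ?_ <;> simp [pow_two, -mul_eq_mul_left_iff]
  · linear_combination hv₁ - a * hv₀ + (d - 2 * b) * hcs
      + (c * (2 * (c - a) * (d - b)) - d * ((c - a) ^ 2 - (d - b) ^ 2)) / 2 * ht
  · linear_combination hv₂ - b * hv₀ - (c - 2 * a) * hcs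
      - (c * ((c - a) ^ 2 - (d - b) ^ 2) + d * (2 * (c - a) * (d - b))) / 2 * ht

/-- The push-forward is linear and passes under the integral. The integrands then agree for each θ,
because X = i x φ and 1 - z̄x is x times the conjugate of x - z. -/
theorem pushG_meanExtension (X : FieldS1) : pushG (meanExtension X) = douadyEarle X := by
  funext z
  have hz := z.2
  set p := poincareEquiv.symm z with hp
  have hpz : (p : Mink) = poincareInv z := rfl
  have hcone := H2_subset_futureCone p.2
  have hsup := continuous_supportFun_exp X
  change fderiv ℝ poincare p (meanField X p) = douadyEarle X z
  rw [meanField, map_smul, ← crossL_apply, ← ContinuousLinearMap.comp_apply,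
    clm_conePot _ _ (continuous_smul_lightPt hsup) hcone, douadyEarle, conePot,
    ← intervalIntegral.integral_const_mul, ← intervalIntegral.integral_smul]
  congr 1 with θ
  have h1 : star (Circle.exp θ : ℂ) = (Circle.exp θ : ℂ)⁻¹ := by
    rw [← Circle.coe_inv, Circle.coe_inv_eq_conj]; rfl
  rw [ContinuousLinearMap.comp_apply, crossL_apply, ← crossL_apply, map_smul, crossL_apply, map_smul,
    hpz, fderiv_poincare_cross hz, mink_poincareInv_lightPt hz, eq_supportFun X,
    one_sub_star_mul_circle, h1]
  have hx := Circle.coe_ne_zero (Circle.exp θ)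
  have hw := circle_sub_ne_zero hz (Circle.exp θ)
  generalize (Circle.exp θ : ℂ) = x at *
  have hw' : star (x - z) ≠ 0 := star_ne_zero.2 hw
  have hww : ((‖x - z‖ ^ 2 : ℝ) : ℂ) = (x - z) * star (x - z) := by
    rw [Complex.star_def, Complex.mul_conj, Complex.normSq_eq_norm_sq]
  have hz1 : ((1 - ‖(z : ℂ)‖ ^ 2 : ℝ) : ℂ) ≠ 0 := by
    rw [mem_ball_zero_iff, ← sq_lt_one_iff₀ (norm_nonneg _)] at hz
    exact Complex.ofReal_ne_zero.2 (by linarith)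
  have hpi : (Real.pi : ℂ) ≠ 0 := Complex.ofReal_ne_zero.2 Real.pi_ne_zero
  simp only [Complex.real_smul, Complex.ofReal_neg, Complex.ofReal_inv, Complex.ofReal_zpow,
    Complex.ofReal_div, hww]
  rw [zpow_neg, show (3 : ℤ) = (3 : ℕ) from rfl, zpow_natCast]
  generalize star (x - z) = w at *
  field_simp

end HalfPipe

end

open HalfPipe
theorem proposition1p4 :
    -- unique mean surface with prescribed boundary at infinity; unique solution of its equation
    (∀ X : FieldS1, ∃! u : H2 → ℝ, IsMeanGraph u ∧ HasBoundaryValue u (supportFun X)) ∧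
    (∀ X : FieldS1, ∃! u : H2 → ℝ, IsMeanSolution u ∧ HasBoundaryValue u (supportFun X)) ∧
    -- the linear operator built from these mean surfaces
    ∃ HL : FieldS1 →L[ℝ] FieldH2,
      (∀ (X : FieldS1) (u : H2 → ℝ), IsMeanGraph u → HasBoundaryValue u (supportFun X) →
        IsSurfaceField u (HL X).1) ∧
      (∀ (X : FieldS1) (u : H2 → ℝ), IsMeanSolution u → HasBoundaryValue u (supportFun X) →
        ∀ p : H2, (HL X).1 p = rotJ p (gradH2 u p)) ∧
      ∀ X : FieldS1, pushG (HL X) = douadyEarle X := by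
  have hex (X : FieldS1) : IsMeanSolution (meanPoisson fun θ => supportFun X (Circle.exp θ)) ∧
      HasBoundaryValue (meanPoisson fun θ => supportFun X (Circle.exp θ)) (supportFun X) :=
    ⟨isMeanSolution_meanPoisson (continuous_supportFun_exp X),
      hasBoundaryValue_meanPoisson (continuous_supportFun_right X)⟩
  have huniq (X : FieldS1) (u : H2 → ℝ) (hu : IsMeanSolution u)
      (hb : HasBoundaryValue u (supportFun X)) :
      u = meanPoisson fun θ => supportFun X (Circle.exp θ) :=
    hu.unique hb (hex X).1 (hex X).2
  refine ⟨fun X => ⟨_, ⟨(isMeanGraph_iff _).2 (hex X).1, (hex X).2⟩, fun u hu =>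
      huniq X u ((isMeanGraph_iff u).1 hu.1) hu.2⟩,
    fun X => ⟨_, hex X, fun u hu => huniq X u hu.1 hu.2⟩, meanExtension, fun X u hu hb => ?_,
    fun X u hu hb p => ?_, pushG_meanExtension⟩
  · rw [huniq X u ((isMeanGraph_iff u).1 hu) hb]
    intro p
    obtain ⟨σ, h1, h2⟩ := (hex X).1.1.isSurfaceField p
    exact ⟨σ, h1, (meanField_eq X p).trans h2⟩
  · rw [huniq X u hu hb]
    exact meanField_eq X p
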